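/- For $X\subseteq\mathbb Z$ and $n\in\mathbb Z$ let $s_n^X$ be the partial isometry of $\ell^2(X)$ with $s_n^X\delta_j=\delta_{j+n}$ if $j+n\in X$ and $s_n^X\delta_j=0$ otherwise, and let the partial translation algebra $C^*(X)\subseteq B(\ell^2(X))$ be the $C^*$-algebra generated by all $s_n^X$, $n\in\mathbb Z$. Let $C^*_\rho(\mathbb Z)\subseteq B(\ell^2(\mathbb Z))$ be the reduced group $C^*$-algebra, generated by the translations $\rho_n:\delta_j\mapsto\delta_{j+n}$; it is identified with $C(S^1)$ by an isomorphism $\gamma:C(S^1)\to C^*_\rho(\mathbb Z)$ with $\gamma(z^n)=\rho_n$ for all $n\in\mathbb Z$. Let $\mathscr K(H)$ denote the compact operators on $H$. **Theorem.** Let $X=\mathbb Z\setminus\{0\}$, and let $U:\ell^2(X)\to\ell^2(\mathbb Z)$ be the unitary induced by the bijection $\phi:X\to\mathbb Z$, $\phi(j)=j$ for $j>0$ and $\phi(j)=j+1$ for $j<0$. Then $$U\,C^*(X)\,U^*=C^*_\rho(\mathbb Z)+\mathscr K(\ell^2(\mathbb Z)).$$ There is an extension $$0\to\mathscr K(\ell^2(X))\to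 C^*(X)\xrightarrow{\;q\;}C(S^1)\to0,\qquad q(s_n^X)=z^n\quad(n\in\mathbb Z),$$ and it is trivial: $q$ is split by a $*$-homomorphism $C(S^1)\to C^*(X)$. Through the unitary $U$ it is represented in $K$-homology by the cycle $(\ell^2(\mathbb Z),\gamma,1)$, which is degenerate. This extension is not equivalent, in the sense of $K$-homology, to the Toeplitz extension $$0\to\mathscr K(\ell^2(\mathbb N))\to\mathscr T\to C(S^1)\to0,$$ where $\mathscr T$ is the $C^*$-algebra generated by the unilateral shift on $\ell^2(\mathbb N)$, which is mapped to $z$. (The Toeplitz extension also is represented by a $K$-homology cycle.) Here a $K$-homology cycle for a $C^*$-algebra $A$ is an odd Fredholm module $(H,\rho,F)$: $H$ is a separable Hilbert space, $\rho$ a $*$-representation of $A$ on $H$ and $F\in B(H)$, with $F\rho(a)-\rho(a)F$, $\rho(a)(F^2-1)$ and $\rho(a)(F-F^*)$ compact for all $a\in A$; it is degenerate if these operators all vanish. Two cycles have the same class in $K^1(A)$ if they are related by the equivalence relation generated by unitary equivalence, operator homotopy (norm continuous paths of $F$) and addition of degenerate cycles. An extension $0\to\mathscr K(H)\to E\to A\to0$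 with $E\subseteq B(H)$ is represented by $(H',\rho,F)$ through an isometry $V:H\to H'$ if $F=2VV^*-1$ and $V^*\rho(a)V$ is a lift of $a$ to $E$ for every $a\in A$. Two extensions are equivalent in the sense of $K$-homology if they are represented by cycles with the same class. -/

import Mathlib

open scoped ENNReal Pointwise

noncomputable section

/-! ### Operators on `ℓ²` induced by partial bijections -/

/-- The Hilbert space `ℓ²(X)` of square summable complex functions on `X`. -/
abbrev Ell2 (X : Type) : Type := lp (fun _ : X => ℂ) 2

/-- The canonical basis vector `δ_x` of `ℓ²(X)`. -/
def ell2Delta {X : Type} (x : X) : Ell2 X :=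
  letI := Classical.decEq X
  lp.single 2 x (1 : ℂ)

/-- The function `y ↦ f (t⁻¹ y)`, extended by zero outside the range of `t`. -/
def transportFun {X : Type} (t : X ≃. X) (f : X → ℂ) (y : X) : ℂ :=
  (t.symm y).elim 0 f

theorem sum_transportFun_le {X : Type} (t : X ≃. X) (f : Ell2 X) (s : Finset X) :
    ∑ y ∈ s, ‖transportFun t f y‖ ^ (2 : ℝ≥0∞).toReal ≤ ‖f‖ ^ (2 : ℝ≥0∞).toReal := by
  classical
  have hinj : ∀ a a' b, b ∈ t.symm a → b ∈ t.symm a' → a = a' :=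
    fun a a' b h h' => t.symm.inj h h'
  have key : ∑ y ∈ s, ‖transportFun t f y‖ ^ (2 : ℝ≥0∞).toReal
      = ∑ x ∈ s.filterMap t.symm hinj, ‖f x‖ ^ (2 : ℝ≥0∞).toReal := by
    induction s using Finset.induction_on with
    | empty => rfl
    | insert a s ha ih =>
      rw [Finset.sum_insert ha, ih]
      rcases h : t.symm a with _ | b
      · have : (insert a s).filterMap t.symm hinj = s.filterMap t.symm hinj := by
          ext x
          simp [Finset.mem_filterMap, h]
        rw [this]
        simp [transportFun, h]
      · have hb : b ∉ s.filterMap t.symm hinj := by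
          simp only [Finset.mem_filterMap, not_exists, not_and]
          intro c hc hcb
          exact ha (hinj c a b hcb h ▸ hc)
        have : (insert a s).filterMap t.symm hinj = insert b (s.filterMap t.symm hinj) := by
          ext x
          simp [Finset.mem_filterMap, h, eq_comm]
        rw [this, Finset.sum_insert hb]
        simp [transportFun, h]
  rw [key]
  exact lp.sum_rpow_le_norm_rpow (by norm_num) f _

/-- The partial isometry of `ℓ²(X)` induced by a partial bijection `t` of `X`:
`δ_x ↦ δ_{t x}` for `x` in the domain of `t`, and `δ_x ↦ 0` otherwise. -/
def inducedOperator {X : Type} (t : X ≃. X) : Ell2 X →L[ℂ] Ell2 X :=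
  LinearMap.mkContinuous
    { toFun := fun f => ⟨transportFun t f, memℓp_gen' (sum_transportFun_le t f)⟩
      map_add' := fun f g => by
        ext y
        change transportFun t ((f : X → ℂ) + (g : X → ℂ)) y =
          transportFun t f y + transportFun t g y
        unfold transportFun
        cases t.symm y
        · exact (add_zero (0 : ℂ)).symm
        · rfl
      map_smul' := fun c f => by
        ext y
        change transportFun t _ y = c • transportFun t _ y
        unfold transportFun
        cases t.symm y <;> simp }
    1 (fun f => by
      rw [one_mul]
      exact lp.norm_le_of_forall_sum_le (by norm_num) (norm_nonneg _) (sum_transportFun_le t f))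

theorem inducedOperator_delta_of_eq_some {X : Type} (t : X ≃. X) {x y : X} (h : t x = some y) :
    inducedOperator t (ell2Delta x) = ell2Delta y := by
  classical
  ext z
  change transportFun t (ell2Delta x) z = ell2Delta y z
  have hy : t.symm y = some x := t.eq_some_iff.2 h
  unfold transportFun ell2Delta
  by_cases hz : z = y
  · subst hz
    simp [hy]
  · rw [lp.single_apply_ne _ _ _ hz]
    rcases hw : t.symm z with _ | w
    · simp
    · have hwx : w ≠ x := by
        rintro rfl
        exact hz (t.symm.inj hw hy)
      simp [hwx]

theorem inducedOperator_delta_of_eq_none {X : Type} (t : X ≃. X) {x : X} (h : t x = none) :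
    inducedOperator t (ell2Delta x) = 0 := by
  classical
  ext z
  change transportFun t (ell2Delta x) z = 0
  unfold transportFun ell2Delta
  rcases hw : t.symm z with _ | w
  · simp
  · have hwx : w ≠ x := by
      rintro rfl
      have := t.eq_some_iff.1 hw
      rw [h] at this
      cases this
    simp [hwx]

/-! ### Partial translation algebras -/

/-- The (not necessarily unital) `C*`-subalgebra of `B(H)` generated by a set of operators. -/
def generatedCStarAlgebra {H : Type} [NormedAddCommGroup H] [InnerProductSpace ℂ H]
    [CompleteSpace H] (S : Set (H →L[ℂ] H)) : NonUnitalStarSubalgebra ℂ (H →L[ℂ] H) :=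
  (NonUnitalStarAlgebra.adjoin ℂ S).topologicalClosure

/-- A partial translation of a metric space: a bijection between two subsets which moves all
points of its domain by a bounded distance. -/
structure PartialTranslation (X : Type) [MetricSpace X] where
  toPEquiv : X ≃. X
  bounded : ∃ C : ℝ, ∀ x y, toPEquiv x = some y → dist x y ≤ C

/-- The partial translation algebra `C*(𝐓)` of a family of partial translations. -/
def partialTranslationAlgebra {X : Type} [MetricSpace X] (T : Set (PartialTranslation X)) :
    NonUnitalStarSubalgebra ℂ (Ell2 X →L[ℂ] Ell2 X) :=
  generatedCStarAlgebra ((fun t => inducedOperator t.toPEquiv) '' T)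

/-- The translation `j ↦ j + n` of `ℤ`, restricted and corestricted to `X ⊆ ℤ`: its domain is
`{j ∈ X | j + n ∈ X}`. -/
def restrictedTranslation (X : Set ℤ) (n : ℤ) : PartialTranslation X where
  toPEquiv :=
    letI := Classical.decPred (· ∈ X)
    { toFun := fun x => if h : (x : ℤ) + n ∈ X then some ⟨x + n, h⟩ else none
      invFun := fun y => if h : (y : ℤ) - n ∈ X then some ⟨y - n, h⟩ else none
      inv := by
        rintro ⟨a, ha⟩ ⟨b, hb⟩
        simp only [Option.dite_none_right_eq_some, Option.some.injEq,
          Subtype.mk.injEq]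
        constructor
        · rintro ⟨_, rfl⟩
          exact ⟨by simpa using hb, by simp⟩
        · rintro ⟨_, rfl⟩
          exact ⟨by simpa using ha, by simp⟩ }
  bounded := ⟨|(n : ℝ)|, by
    rintro ⟨a, ha⟩ ⟨b, hb⟩ h
    simp only [PEquiv.coe_mk, Option.dite_none_right_eq_some, Option.some.injEq,
      Subtype.mk.injEq] at h
    obtain ⟨_, rfl⟩ := h
    rw [Subtype.dist_eq, Int.dist_eq]
    push_cast
    rw [sub_add_cancel_left, abs_neg]⟩

/-- The partial translation algebra `C*(X)` of a subspace `X ⊆ ℤ`. -/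
def translationAlgebra (X : Set ℤ) : NonUnitalStarSubalgebra ℂ (Ell2 X →L[ℂ] Ell2 X) :=
  partialTranslationAlgebra (Set.range (restrictedTranslation X))

/-- The operator on `ℓ²(X)` given by the restriction of `j ↦ j + n` to `X ⊆ ℤ`. -/
def translationOperator (X : Set ℤ) (n : ℤ) : Ell2 X →L[ℂ] Ell2 X :=
  inducedOperator (restrictedTranslation X n).toPEquiv

/-- The subspace `ℤ ∖ {0}` of `ℤ`. -/
def puncturedInt : Set ℤ := {j | j ≠ 0}

/-- The map `ℤ ∖ {0} → ℤ` closing the gap: `j ↦ j` for `j > 0` and `j ↦ j + 1` for `j < 0`. -/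
def closeGap (j : puncturedInt) : ℤ := if 0 < (j : ℤ) then (j : ℤ) else (j : ℤ) + 1

/-- The operator `ρ_n` on `ℓ²(ℤ)` given by right translation `δ_j ↦ δ_{j + n}`. -/
def rightTranslation (n : ℤ) : Ell2 ℤ →L[ℂ] Ell2 ℤ :=
  inducedOperator (Equiv.addRight n).toPEquiv

/-- The reduced group `C*`-algebra `C*_ρ(ℤ) ⊆ B(ℓ²(ℤ))`. -/
def reducedGroupAlgebra : NonUnitalStarSubalgebra ℂ (Ell2 ℤ →L[ℂ] Ell2 ℤ) :=
  generatedCStarAlgebra (Set.range rightTranslation)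

/-- The unilateral shift `δ_j ↦ δ_{j + 1}` on `ℓ²(ℕ)`. -/
def unilateralShift : Ell2 ℕ →L[ℂ] Ell2 ℕ :=
  inducedOperator
    { toFun := fun j => some (j + 1)
      invFun := fun k => if k = 0 then none else some (k - 1)
      inv := by
        intro a b
        simp only [Option.ite_none_left_eq_some, Option.some.injEq]
        omega }

/-- The Toeplitz algebra, generated by the unilateral shift. -/
def toeplitzAlgebra : NonUnitalStarSubalgebra ℂ (Ell2 ℕ →L[ℂ] Ell2 ℕ) :=
  generatedCStarAlgebra {unilateralShift}

/-- The function `w ↦ wⁿ` on the unit circle. -/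
def circlePow (n : ℤ) : C(Circle, ℂ) := ⟨fun w => ((w ^ n : Circle) : ℂ),
  continuous_subtype_val.comp (continuous_zpow n)⟩

/-! ### Extensions by the compact operators -/

/-- The compact operators on a Hilbert space. -/
def compactOps (H : Type) [NormedAddCommGroup H] [InnerProductSpace ℂ H] : Set (H →L[ℂ] H) :=
  {T | IsCompactOperator T}

/-- An extension `0 → 𝒦(H) → E → A → 0` of `A` by the compact operators, where `E` is a
`C*`-algebra of operators on `H` containing the compact operators. -/
structure CompactExtension (A : Type) [NonUnitalCStarAlgebra A] (H : Type)
    [NormedAddCommGroup H] [InnerProductSpace ℂ H] [CompleteSpace H] where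
  algebra : NonUnitalStarSubalgebra ℂ (H →L[ℂ] H)
  closed : IsClosed (algebra : Set (H →L[ℂ] H))
  compact_mem : compactOps H ⊆ algebra
  quot : algebra →⋆ₙₐ[ℂ] A
  surjective : Function.Surjective quot
  ker : ∀ T : algebra, quot T = 0 ↔ (T : H →L[ℂ] H) ∈ compactOps H

section Extension

variable {A : Type} [NonUnitalCStarAlgebra A]
  {H : Type} [NormedAddCommGroup H] [InnerProductSpace ℂ H] [CompleteSpace H]

/-- `T` belongs to the algebra of the extension and is mapped to `a` by the quotient map. -/
def CompactExtension.Lifts (e : CompactExtension A H) (T : H →L[ℂ] H) (a : A) : Prop :=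
  ∃ h : T ∈ e.algebra, e.quot ⟨T, h⟩ = a

/-- The extension is trivial: the quotient map has a right inverse that is a `*`-homomorphism. -/
def CompactExtension.IsTrivial (e : CompactExtension A H) : Prop :=
  ∃ σ : A →⋆ₙₐ[ℂ] e.algebra, ∀ a, e.quot (σ a) = a

end Extension

/-! ### `K`-homology -/

/-- An odd (ungraded) Fredholm module `(H, ρ, F)` over a `C*`-algebra `A`, i.e. a cycle for
`K¹(A)`. -/
structure FredholmModule (A : Type) [NonUnitalCStarAlgebra A] where
  H : Type
  [normedAddCommGroup : NormedAddCommGroup H]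
  [innerProductSpace : InnerProductSpace ℂ H]
  [completeSpace : CompleteSpace H]
  [separableSpace : TopologicalSpace.SeparableSpace H]
  rep : A →⋆ₙₐ[ℂ] (H →L[ℂ] H)
  F : H →L[ℂ] H
  comm : ∀ a, F * rep a - rep a * F ∈ compactOps H
  sq : ∀ a, rep a * (F * F - 1) ∈ compactOps H
  selfAdj : ∀ a, rep a * (F - star F) ∈ compactOps H

attribute [instance] FredholmModule.normedAddCommGroup FredholmModule.innerProductSpace
  FredholmModule.completeSpace FredholmModule.separableSpace

section DirectSum

variable {H K : Type} [NormedAddCommGroup H] [InnerProductSpace ℂ H]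
  [NormedAddCommGroup K] [InnerProductSpace ℂ K]

/-- The operator `S ⊕ T` on the Hilbert space direct sum `H ⊕ K`. -/
def directSumOp (S : H →L[ℂ] H) (T : K →L[ℂ] K) :
    WithLp 2 (H × K) →L[ℂ] WithLp 2 (H × K) :=
  ((WithLp.prodContinuousLinearEquiv 2 ℂ H K).symm : H × K →L[ℂ] WithLp 2 (H × K)) ∘L
    (S.prodMap T) ∘L
      ((WithLp.prodContinuousLinearEquiv 2 ℂ H K) : WithLp 2 (H × K) →L[ℂ] H × K)

theorem directSumOp_apply (S : H →L[ℂ] H) (T : K →L[ℂ] K) (v : WithLp 2 (H × K)) :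
    directSumOp S T v = WithLp.toLp 2 (S v.fst, T v.snd) := rfl

theorem directSumOp_zero : directSumOp (0 : H →L[ℂ] H) (0 : K →L[ℂ] K) = 0 := rfl

theorem directSumOp_one : directSumOp (1 : H →L[ℂ] H) (1 : K →L[ℂ] K) = 1 := rfl

theorem directSumOp_add (S S' : H →L[ℂ] H) (T T' : K →L[ℂ] K) :
    directSumOp (S + S') (T + T') = directSumOp S T + directSumOp S' T' := rfl

theorem directSumOp_sub (S S' : H →L[ℂ] H) (T T' : K →L[ℂ] K) :
    directSumOp (S - S') (T - T') = directSumOp S T - directSumOp S' T' := rfl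

theorem directSumOp_smul (c : ℂ) (S : H →L[ℂ] H) (T : K →L[ℂ] K) :
    directSumOp (c • S) (c • T) = c • directSumOp S T := rfl

theorem directSumOp_mul (S S' : H →L[ℂ] H) (T T' : K →L[ℂ] K) :
    directSumOp (S * S') (T * T') = directSumOp S T * directSumOp S' T' := rfl

theorem directSumOp_star [CompleteSpace H] [CompleteSpace K] (S : H →L[ℂ] H) (T : K →L[ℂ] K) :
    directSumOp (star S) (star T) = star (directSumOp S T) := by
  rw [ContinuousLinearMap.star_eq_adjoint, ContinuousLinearMap.star_eq_adjoint,
    ContinuousLinearMap.star_eq_adjoint, ContinuousLinearMap.eq_adjoint_iff]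
  intro x y
  simp [directSumOp_apply, ContinuousLinearMap.adjoint_inner_left]

theorem directSumOp_compact {S : H →L[ℂ] H} {T : K →L[ℂ] K} (hS : S ∈ compactOps H)
    (hT : T ∈ compactOps K) : directSumOp S T ∈ compactOps (WithLp 2 (H × K)) := by
  change IsCompactOperator S at hS
  change IsCompactOperator T at hT
  change IsCompactOperator (directSumOp S T)
  have e : (directSumOp S T : WithLp 2 (H × K) → WithLp 2 (H × K)) =
      ((WithLp.prodContinuousLinearEquiv 2 ℂ H K).symm ∘L ContinuousLinearMap.inl ℂ H K) ∘
        (S ∘ (ContinuousLinearMap.fst ℂ H K ∘L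
          ((WithLp.prodContinuousLinearEquiv 2 ℂ H K) : WithLp 2 (H × K) →L[ℂ] H × K))) +
      ((WithLp.prodContinuousLinearEquiv 2 ℂ H K).symm ∘L ContinuousLinearMap.inr ℂ H K) ∘
        (T ∘ (ContinuousLinearMap.snd ℂ H K ∘L
          ((WithLp.prodContinuousLinearEquiv 2 ℂ H K) : WithLp 2 (H × K) →L[ℂ] H × K))) := by
    funext v
    apply (WithLp.prodContinuousLinearEquiv 2 ℂ H K).injective
    change (S v.fst, T v.snd) = (S v.fst, 0) + (0, T v.snd)
    simp
  rw [e]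
  exact ((hS.comp_clm _).clm_comp _).add ((hT.comp_clm _).clm_comp _)

end DirectSum

namespace FredholmModule

variable {A : Type} [NonUnitalCStarAlgebra A]

/-- The direct sum of two Fredholm modules. -/
def directSum (x y : FredholmModule A) : FredholmModule A where
  H := WithLp 2 (x.H × y.H)
  separableSpace :=
    (WithLp.prodContinuousLinearEquiv 2 ℂ x.H y.H).symm.surjective.denseRange.separableSpace
      (WithLp.prodContinuousLinearEquiv 2 ℂ x.H y.H).symm.continuous
  rep :=
    { toFun := fun a => directSumOp (x.rep a) (y.rep a)
      map_smul' := fun c a => by simp [map_smul, directSumOp_smul]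
      map_zero' := by simp [directSumOp_zero]
      map_add' := fun a b => by simp [directSumOp_add]
      map_mul' := fun a b => by simp [directSumOp_mul]
      map_star' := fun a => by simp only [map_star, directSumOp_star] }
  F := directSumOp x.F y.F
  comm := fun a => by
    change directSumOp x.F y.F * directSumOp (x.rep a) (y.rep a) -
      directSumOp (x.rep a) (y.rep a) * directSumOp x.F y.F
      ∈ compactOps (WithLp 2 (x.H × y.H))
    rw [← directSumOp_mul, ← directSumOp_mul, ← directSumOp_sub]
    exact directSumOp_compact (x.comm a) (y.comm a)
  sq := fun a => by
    change directSumOp (x.rep a) (y.rep a) *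
      (directSumOp x.F y.F * directSumOp x.F y.F - 1)
      ∈ compactOps (WithLp 2 (x.H × y.H))
    rw [← directSumOp_one, ← directSumOp_mul, ← directSumOp_sub, ← directSumOp_mul]
    exact directSumOp_compact (x.sq a) (y.sq a)
  selfAdj := fun a => by
    change directSumOp (x.rep a) (y.rep a) *
      (directSumOp x.F y.F - star (directSumOp x.F y.F))
      ∈ compactOps (WithLp 2 (x.H × y.H))
    rw [← directSumOp_star, ← directSumOp_sub, ← directSumOp_mul]
    exact directSumOp_compact (x.selfAdj a) (y.selfAdj a)

/-- A Fredholm module is degenerate if its defining relations hold exactly. -/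
def IsDegenerate (x : FredholmModule A) : Prop :=
  ∀ a, x.F * x.rep a - x.rep a * x.F = 0 ∧ x.rep a * (x.F * x.F - 1) = 0 ∧
    x.rep a * (x.F - star x.F) = 0

/-- Unitary equivalence of Fredholm modules. -/
def UnitarilyEquivalent (x y : FredholmModule A) : Prop :=
  ∃ U : x.H ≃ₗᵢ[ℂ] y.H, (∀ a, U.conjStarAlgEquiv (x.rep a) = y.rep a) ∧
    U.conjStarAlgEquiv x.F = y.F

/-- Operator homotopy: `x = (H, ρ, F₀)` and `y = (H, ρ, F₁)` are joined by a norm continuous path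
of Fredholm modules `(H, ρ, F_t)`, `t ∈ [0,1]`. -/
def OperatorHomotopic (x y : FredholmModule A) : Prop :=
  ∃ (H : Type) (_ : NormedAddCommGroup H) (_ : InnerProductSpace ℂ H) (_ : CompleteSpace H)
    (_ : TopologicalSpace.SeparableSpace H) (rep : A →⋆ₙₐ[ℂ] (H →L[ℂ] H))
    (F : unitInterval → (H →L[ℂ] H))
    (comm : ∀ t a, F t * rep a - rep a * F t ∈ compactOps H)
    (sq : ∀ t a, rep a * (F t * F t - 1) ∈ compactOps H)
    (selfAdj : ∀ t a, rep a * (F t - star (F t)) ∈ compactOps H),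
    Continuous F ∧ x = ⟨H, rep, F 0, comm 0, sq 0, selfAdj 0⟩ ∧
      y = ⟨H, rep, F 1, comm 1, sq 1, selfAdj 1⟩

/-- Equality of classes in `K¹(A)`: the equivalence relation generated by unitary equivalence,
operator homotopy and addition of degenerate Fredholm modules. -/
def KHomologous : FredholmModule A → FredholmModule A → Prop :=
  Relation.EqvGen fun x y => UnitarilyEquivalent x y ∨ OperatorHomotopic x y ∨
    ∃ d : FredholmModule A, d.IsDegenerate ∧ y = x.directSum d

end FredholmModule

namespace CompactExtension

variable {A : Type} [NonUnitalCStarAlgebra A]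
  {H : Type} [NormedAddCommGroup H] [InnerProductSpace ℂ H] [CompleteSpace H]
  {K : Type} [NormedAddCommGroup K] [InnerProductSpace ℂ K] [CompleteSpace K]

/-- The Fredholm module `x = (H', ρ, F)` represents the extension via the isometry `V : H → H'`:
`F = 2P - 1` with `P = V V*` the projection onto the range of `V`, and the compression
`V* ρ(a) V` is a lift of `a`, for every `a`. -/
def RepresentedVia (e : CompactExtension A H) (x : FredholmModule A) (V : H →ₗᵢ[ℂ] x.H) : Prop :=
  x.F = (2 : ℂ) • (V.toContinuousLinearMap ∘L
      ContinuousLinearMap.adjoint V.toContinuousLinearMap) - 1 ∧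
    ∀ a, e.Lifts (ContinuousLinearMap.adjoint V.toContinuousLinearMap ∘L x.rep a ∘L
      V.toContinuousLinearMap) a

/-- The Fredholm module `x` represents the extension, so that the class of `x` in `K¹(A)` is
the `K`-homology class of the extension. -/
def RepresentedBy (e : CompactExtension A H) (x : FredholmModule A) : Prop :=
  ∃ V : H →ₗᵢ[ℂ] x.H, e.RepresentedVia x V

/-- Equivalence of extensions in the sense of `K`-homology: they define the same class. -/
def KHomologyEquivalent (e : CompactExtension A H) (e' : CompactExtension A K) : Prop :=
  ∃ x y : FredholmModule A, e.RepresentedBy x ∧ e'.RepresentedBy y ∧ x.KHomologous y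

end CompactExtension

instance ell2SeparableSpace (X : Type) [Countable X] :
    TopologicalSpace.SeparableSpace (Ell2 X) := by
  classical
  have h1 : TopologicalSpace.IsSeparable
      (closure (Submodule.span ℂ (Set.range (ell2Delta (X := X))) : Set (Ell2 X))) :=
    ((Set.countable_range _).isSeparable.span (R := ℂ)).closure
  have h2 : closure (Submodule.span ℂ (Set.range (ell2Delta (X := X))) : Set (Ell2 X))
      = Set.univ := by
    refine Set.eq_univ_of_forall fun f => ?_
    refine mem_closure_of_tendsto (lp.hasSum_single (p := 2) (by norm_num) f)
      (Filter.Eventually.of_forall fun s => ?_)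
    refine Submodule.sum_mem _ fun i _ => ?_
    have : lp.single 2 i (f i) = f i • ell2Delta i := by
      unfold ell2Delta
      rw [← lp.single_smul]
      simp
    rw [this]
    exact Submodule.smul_mem _ _ (Submodule.subset_span ⟨i, rfl⟩)
  rw [h2] at h1
  exact TopologicalSpace.isSeparable_univ_iff.1 h1

/-- The Fredholm module `(ℓ²(ℤ), ρ, 1)` of a representation `ρ` of `A` on `ℓ²(ℤ)`. -/
def regularModule {A : Type} [NonUnitalCStarAlgebra A]
    (ρ : A →⋆ₙₐ[ℂ] (Ell2 ℤ →L[ℂ] Ell2 ℤ)) : FredholmModule A where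
  H := Ell2 ℤ
  rep := ρ
  F := 1
  comm := fun a => by
    rw [one_mul, mul_one, sub_self]
    exact isCompactOperator_zero
  sq := fun a => by
    rw [one_mul, sub_self, mul_zero]
    exact isCompactOperator_zero
  selfAdj := fun a => by
    rw [star_one, sub_self, mul_zero]
    exact isCompactOperator_zero

/-- The representation of `C(S¹)` on `ℓ²(ℤ)` given by an identification of `C(S¹)` with
`C*_ρ(ℤ)`. -/
def regularRep (γ : C(Circle, ℂ) ≃⋆ₐ[ℂ] reducedGroupAlgebra) :
    C(Circle, ℂ) →⋆ₙₐ[ℂ] (Ell2 ℤ →L[ℂ] Ell2 ℤ) :=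
  (NonUnitalStarSubalgebraClass.subtype reducedGroupAlgebra).comp
    (γ : C(Circle, ℂ) →⋆ₙₐ[ℂ] reducedGroupAlgebra)

end

/-! Closing the gap turns $s_n$ into $\rho_n$ up to finite rank: if $|j|>|n|$ then $j$ and $j+n$ lie
on the same side of $0$, so $\phi(j+n)=\phi(j)+n$. The hole itself produces the compacts, because
$s_0-s_{-1}s_1$ is the projection onto $\mathbb C\delta_{-1}$ and the $s_n$ move $\delta_{-1}$ to
every other basis vector. Hence $C^*(X)=U^*C^*_\rho(\mathbb Z)U+\mathscr K$, and $f\mapsto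
U^*\gamma(f)U$ splits the quotient; the range projection of $U$ is $1$, so the cycle has $F=1$.

Both extensions are instances of one construction. Given an isometry $V$ into $\ell^2(\mathbb Z)$ as
in `IsToeplitzIsometry`, take the operators $V^*\gamma(f)V+K$ with $K$ compact. The key estimate
`IsToeplitzIsometry.norm_le` says that such an operator has norm at least $\|f\|$: translated far to
the right, a vector no longer sees $K$ or the complement of the range of $V$. This makes the symbol
$f$ unique, hence the symbol map a $*$-homomorphism, and makes the algebra closed. Taking $V=U$
gives the punctured line, and taking the inclusion of $\ell^2(\mathbb N)$ gives the Toeplitz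
extension.

The extensions are told apart by the index of the compression of $z$. Only the vanishing of the
index is needed, and `NullIndex` expresses it without defining an index. For a cycle $(H,\rho,F)$
put $P=\frac12(F+1)$; then $1+P\rho(z-1)$ plays the role of the compression of $z$ extended by the
identity. Vanishing of its index survives the three moves generating the equivalence of cycles
(`KHomologous.nullIndex_iff`), and for a cycle representing an extension it can be read off from any
lift of $z$ (`RepresentedVia.indexOperator_sub_mem`). For the punctured line $z$ has a unitary lift;
for the Toeplitz extension the lift is the shift, injective but not surjective, which
`NullIndex.surjective_of_injective` forbids in index zero. -/

noncomputable section

/-! ### The ideal of compact operators -/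

section Compact

variable {H : Type} [NormedAddCommGroup H] [InnerProductSpace ℂ H]

theorem zero_mem_compactOps : (0 : H →L[ℂ] H) ∈ compactOps H := isCompactOperator_zero

theorem add_mem_compactOps {S T : H →L[ℂ] H} (hS : S ∈ compactOps H) (hT : T ∈ compactOps H) :
    S + T ∈ compactOps H := IsCompactOperator.add hS hT

theorem sub_mem_compactOps {S T : H →L[ℂ] H} (hS : S ∈ compactOps H) (hT : T ∈ compactOps H) :
    S - T ∈ compactOps H := IsCompactOperator.sub hS hT

theorem neg_mem_compactOps {S : H →L[ℂ] H} (hS : S ∈ compactOps H) :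
    -S ∈ compactOps H := IsCompactOperator.neg hS

theorem smul_mem_compactOps (c : ℂ) {S : H →L[ℂ] H} (hS : S ∈ compactOps H) :
    c • S ∈ compactOps H := IsCompactOperator.smul hS c

theorem mul_left_mem_compactOps (S : H →L[ℂ] H) {T : H →L[ℂ] H} (hT : T ∈ compactOps H) :
    S * T ∈ compactOps H := IsCompactOperator.clm_comp hT S

theorem mul_right_mem_compactOps {S : H →L[ℂ] H} (hS : S ∈ compactOps H) (T : H →L[ℂ] H) :
    S * T ∈ compactOps H := IsCompactOperator.comp_clm hS T

theorem sub_mem_compactOps_comm {S T : H →L[ℂ] H} (h : S - T ∈ compactOps H) :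
    T - S ∈ compactOps H := by
  simpa using neg_mem_compactOps h

end Compact

/-! ### Transport of operators along isometries -/

section Dilation

variable {H K L : Type} [NormedAddCommGroup H] [InnerProductSpace ℂ H] [CompleteSpace H]
  [NormedAddCommGroup K] [InnerProductSpace ℂ K] [CompleteSpace K]
  [NormedAddCommGroup L] [InnerProductSpace ℂ L] [CompleteSpace L]

/-- The operator `W B W*` on `L` obtained from `B` on `H` and an isometry `W : H → L`. -/
def dilation (W : H →ₗᵢ[ℂ] L) (B : H →L[ℂ] H) : L →L[ℂ] L :=
  W.toContinuousLinearMap ∘L B ∘L ContinuousLinearMap.adjoint W.toContinuousLinearMap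

/-- The operator `V* A V` on `H` obtained from `A` on `L` and an isometry `V : H → L`. -/
def compression (V : H →ₗᵢ[ℂ] L) (A : L →L[ℂ] L) : H →L[ℂ] H :=
  ContinuousLinearMap.adjoint V.toContinuousLinearMap ∘L A ∘L V.toContinuousLinearMap

theorem adjoint_isometry_apply (W : H →ₗᵢ[ℂ] L) (v : H) :
    ContinuousLinearMap.adjoint W.toContinuousLinearMap (W v) = v := by
  refine ext_inner_left ℂ fun w => ?_
  rw [ContinuousLinearMap.adjoint_inner_right]
  exact W.inner_map_map w v

theorem dilation_apply (W : H →ₗᵢ[ℂ] L) (B : H →L[ℂ] H) (v : L) :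
    dilation W B v = W (B (ContinuousLinearMap.adjoint W.toContinuousLinearMap v)) := rfl

theorem compression_apply (V : H →ₗᵢ[ℂ] L) (A : L →L[ℂ] L) (v : H) :
    compression V A v = ContinuousLinearMap.adjoint V.toContinuousLinearMap (A (V v)) := rfl

theorem dilation_add (W : H →ₗᵢ[ℂ] L) (B C : H →L[ℂ] H) :
    dilation W (B + C) = dilation W B + dilation W C := by
  ext v; simp [dilation_apply]

theorem dilation_sub (W : H →ₗᵢ[ℂ] L) (B C : H →L[ℂ] H) :
    dilation W (B - C) = dilation W B - dilation W C := by
  ext v; simp [dilation_apply]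

theorem dilation_zero (W : H →ₗᵢ[ℂ] L) : dilation W 0 = 0 := by
  ext v; simp [dilation_apply]

theorem dilation_mul (W : H →ₗᵢ[ℂ] L) (B C : H →L[ℂ] H) :
    dilation W (B * C) = dilation W B * dilation W C := by
  ext v; simp [dilation_apply, adjoint_isometry_apply]

theorem adjoint_comp_isometry (W : K →ₗᵢ[ℂ] L) (V : H →ₗᵢ[ℂ] K) (v : L) :
    ContinuousLinearMap.adjoint (W.comp V).toContinuousLinearMap v =
      ContinuousLinearMap.adjoint V.toContinuousLinearMap
        (ContinuousLinearMap.adjoint W.toContinuousLinearMap v) := by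
  refine ext_inner_left ℂ fun w => ?_
  simp only [ContinuousLinearMap.adjoint_inner_right]
  rfl

theorem dilation_comp (W : K →ₗᵢ[ℂ] L) (V : H →ₗᵢ[ℂ] K) (B : H →L[ℂ] H) :
    dilation (W.comp V) B = dilation W (dilation V B) := by
  ext v
  simp only [dilation_apply, adjoint_comp_isometry]
  rfl

/-- The map $1+B\mapsto 1+WBW^*$ extends an operator by the identity on the complement of the range
of $W$, hence is multiplicative and unital even when $W$ is not onto. This is why operators are
written as $1+B$ from here on. -/
theorem one_add_dilation_mul (W : H →ₗᵢ[ℂ] L) (B C : H →L[ℂ] H) :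
    (1 + dilation W B) * (1 + dilation W C) = 1 + dilation W (B + C + B * C) := by
  rw [dilation_add, dilation_add, dilation_mul]
  noncomm_ring

theorem dilation_mem_compactOps (W : H →ₗᵢ[ℂ] L) {B : H →L[ℂ] H} (hB : B ∈ compactOps H) :
    dilation W B ∈ compactOps L :=
  IsCompactOperator.clm_comp (IsCompactOperator.comp_clm hB
    (ContinuousLinearMap.adjoint W.toContinuousLinearMap)) W.toContinuousLinearMap

theorem compression_mem_compactOps (V : H →ₗᵢ[ℂ] L) {A : L →L[ℂ] L} (hA : A ∈ compactOps L) :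
    compression V A ∈ compactOps H :=
  IsCompactOperator.clm_comp (IsCompactOperator.comp_clm hA V.toContinuousLinearMap)
    (ContinuousLinearMap.adjoint V.toContinuousLinearMap)

theorem continuous_dilation (W : H →ₗᵢ[ℂ] L) : Continuous (dilation W) := by
  unfold dilation
  fun_prop

theorem isUnit_one_add_dilation (W : H →ₗᵢ[ℂ] L) {B : H →L[ℂ] H} (hB : IsUnit (1 + B)) :
    IsUnit (1 + dilation W B) := by
  obtain ⟨u, hu⟩ := hB
  have h1 : B + (↑u⁻¹ - 1) + B * (↑u⁻¹ - 1) = 0 := by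
    have : (1 + B) * ↑u⁻¹ = 1 := by rw [← hu, u.mul_inv]
    calc _ = (1 + B) * ↑u⁻¹ - 1 := by noncomm_ring
      _ = 0 := by rw [this, sub_self]
  have h2 : (↑u⁻¹ - 1) + B + (↑u⁻¹ - 1) * B = 0 := by
    have : ↑u⁻¹ * (1 + B) = 1 := by rw [← hu, u.inv_mul]
    calc _ = ↑u⁻¹ * (1 + B) - 1 := by noncomm_ring
      _ = 0 := by rw [this, sub_self]
  exact ⟨⟨1 + dilation W B, 1 + dilation W (↑u⁻¹ - 1),
    by rw [one_add_dilation_mul, h1, dilation_zero, add_zero],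
    by rw [one_add_dilation_mul, h2, dilation_zero, add_zero]⟩, rfl⟩

end Dilation

/-! ### Vanishing of the index and its stability -/

section NullIndex

variable {H K : Type} [NormedAddCommGroup H] [InnerProductSpace ℂ H] [CompleteSpace H]
  [NormedAddCommGroup K] [InnerProductSpace ℂ K] [CompleteSpace K]

/-- After a stabilization, `1 + B` is a compact perturbation of an invertible operator. For a
Fredholm operator `1 + B` this says that its index vanishes. -/
def NullIndex (B : H →L[ℂ] H) : Prop :=
  ∃ (L : Type) (_ : NormedAddCommGroup L) (_ : InnerProductSpace ℂ L) (_ : CompleteSpace L)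
    (W : H →ₗᵢ[ℂ] L) (G : (L →L[ℂ] L)ˣ), 1 + dilation W B - G ∈ compactOps L

theorem NullIndex.of_isUnit {B : H →L[ℂ] H} (hB : IsUnit (1 + B)) : NullIndex B := by
  obtain ⟨G, hG⟩ := isUnit_one_add_dilation LinearIsometry.id hB
  refine ⟨H, inferInstance, inferInstance, inferInstance, LinearIsometry.id, G, ?_⟩
  rw [hG, sub_self]
  exact zero_mem_compactOps

theorem NullIndex.of_dilation {V : H →ₗᵢ[ℂ] K} {B : H →L[ℂ] H} (h : NullIndex (dilation V B)) :
    NullIndex B := by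
  obtain ⟨L, _, _, _, W, G, hG⟩ := h
  exact ⟨L, _, _, inferInstance, W.comp V, G, by rwa [dilation_comp]⟩

theorem NullIndex.compact_perturbation {B C : H →L[ℂ] H} (h : NullIndex B)
    (hBC : B - C ∈ compactOps H) : NullIndex C := by
  obtain ⟨L, _, _, _, W, G, hG⟩ := h
  refine ⟨L, _, _, inferInstance, W, G, ?_⟩
  have := sub_mem_compactOps hG (dilation_mem_compactOps W hBC)
  rw [dilation_sub] at this
  convert this using 1
  abel

theorem nullIndex_congr {B C : H →L[ℂ] H} (hBC : B - C ∈ compactOps H) :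
    NullIndex B ↔ NullIndex C :=
  ⟨fun h => h.compact_perturbation hBC,
    fun h => h.compact_perturbation (sub_mem_compactOps_comm hBC)⟩

/-- Fredholm alternative: the stabilized operator $T$ is still injective and $G^{-1}T$ is $1$ plus a
compact operator, so $T$ is invertible; applying $W^*$ brings surjectivity back to $1+B$. -/
theorem NullIndex.surjective_of_injective {B : H →L[ℂ] H} (h : NullIndex B)
    (hB : Function.Injective (1 + B : H →L[ℂ] H)) : Function.Surjective (1 + B : H →L[ℂ] H) := by
  obtain ⟨L, _, _, _, W, G, hG⟩ := h
  set T := 1 + dilation W B with hT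
  have happ : ∀ v, ContinuousLinearMap.adjoint W.toContinuousLinearMap (T v) =
      (1 + B : H →L[ℂ] H) (ContinuousLinearMap.adjoint W.toContinuousLinearMap v) := by
    intro v
    simp [hT, dilation_apply, adjoint_isometry_apply]
  have hinj : ∀ v, T v = 0 → v = 0 := by
    intro v hv
    have h1 := happ v
    rw [hv, map_zero] at h1
    have h2 : ContinuousLinearMap.adjoint W.toContinuousLinearMap v = 0 :=
      hB (by rw [← h1, map_zero])
    simpa [hT, dilation_apply, h2] using hv
  have hC : IsCompactOperator ((↑G⁻¹ : L →L[ℂ] L) * (T - (G : L →L[ℂ] L))) :=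
    mul_left_mem_compactOps _ hG
  have hGT : (↑G⁻¹ : L →L[ℂ] L) * (T - (G : L →L[ℂ] L)) = ↑G⁻¹ * T - 1 := by rw [mul_sub, G.inv_mul]
  have hunit : IsUnit T := by
    -- The dichotomy is applied at $-1$ to the compact operator $G^{-1}T-1$: an eigenvector for $-1$
    -- would lie in the kernel of $T$.
    rcases IsCompactOperator.hasEigenvalue_or_mem_resolventSet hC
      (neg_ne_zero.2 (one_ne_zero : (1 : ℂ) ≠ 0)) with he | hr
    · obtain ⟨v, hv⟩ := he.exists_hasEigenvector
      have h1 := hv.apply_eq_smul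
      rw [hGT] at h1
      have h2 : (↑G⁻¹ : L →L[ℂ] L) (T v) = 0 := by simpa using h1
      have h3 : T v = (G : L →L[ℂ] L) ((↑G⁻¹ : L →L[ℂ] L) (T v)) := by
        rw [← mul_apply_eq_comp, G.mul_inv]; rfl
      rw [h2, map_zero] at h3
      exact absurd (hinj v h3) hv.2
    · rw [spectrum.mem_resolventSet_iff, hGT] at hr
      have h4 : algebraMap ℂ (L →L[ℂ] L) (-1) - (↑G⁻¹ * T - 1) = -(↑G⁻¹ * T) := by
        simp only [map_neg, map_one]
        abel
      rw [h4, IsUnit.neg_iff] at hr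
      have := G.isUnit.mul hr
      rwa [← mul_assoc, G.mul_inv, one_mul] at this
  intro w
  obtain ⟨u, hu⟩ := hunit
  refine ⟨ContinuousLinearMap.adjoint W.toContinuousLinearMap ((↑u⁻¹ : L →L[ℂ] L) (W w)), ?_⟩
  rw [← happ, ← hu, ← mul_apply_eq_comp, u.mul_inv]
  exact adjoint_isometry_apply W w

/-- Invertible operators form an open set, so $G$ can be moved along with $C-B$. -/
theorem NullIndex.eventually {B : H →L[ℂ] H} (h : NullIndex B) :
    ∀ᶠ C in nhds B, NullIndex C := by
  obtain ⟨L, _, _, _, W, G, hG⟩ := h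
  have hcont : Continuous fun C => (G : L →L[ℂ] L) + dilation W (C - B) :=
    continuous_const.add ((continuous_dilation W).comp (continuous_id.sub continuous_const))
  have hopen : IsOpen {C | IsUnit ((G : L →L[ℂ] L) + dilation W (C - B))} :=
    Units.isOpen.preimage hcont
  have hmem : IsUnit ((G : L →L[ℂ] L) + dilation W (B - B)) := by
    rw [sub_self, dilation_zero, add_zero]; exact G.isUnit
  filter_upwards [hopen.mem_nhds hmem] with C hC
  obtain ⟨G', hG'⟩ := hC
  refine ⟨L, _, _, inferInstance, W, G', ?_⟩
  rw [hG', dilation_sub]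
  convert hG using 1
  abel

/-- If `1 + S` is a right inverse of `1 + B` modulo the compact operators and the index of
`1 + S` vanishes, then so does that of `1 + B`. -/
theorem NullIndex.of_parametrix {B S : H →L[ℂ] H} (hBS : B + S + B * S ∈ compactOps H)
    (h : NullIndex S) : NullIndex B := by
  obtain ⟨L, _, _, _, W, G, hG⟩ := h
  refine ⟨L, _, _, inferInstance, W, G⁻¹, ?_⟩
  have h1 : (1 + dilation W B) * (1 + dilation W S) - 1 ∈ compactOps L := by
    rw [one_add_dilation_mul, add_sub_cancel_left]
    exact dilation_mem_compactOps W hBS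
  have h2 := mul_right_mem_compactOps (sub_mem_compactOps h1
    (mul_left_mem_compactOps (1 + dilation W B) hG)) (↑G⁻¹ : L →L[ℂ] L)
  convert h2 using 1
  calc _ = (1 + dilation W B) * (G * ↑G⁻¹) - ↑G⁻¹ := by rw [G.mul_inv, mul_one]
    _ = _ := by noncomm_ring

/-- Not only the property but also its failure is open at an operator with a right parametrix.
Modulo compacts $(1+C)(1+S)$ equals $1+(C-B)(1+S)$, which is invertible for $C$ near $B$. If $1+C$
had index zero, so would $1+S$, and then $1+B$ by `NullIndex.of_parametrix`. -/
theorem eventually_nullIndex_iff {B S : H →L[ℂ] H} (hBS : B + S + B * S ∈ compactOps H) :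
    ∀ᶠ C in nhds B, NullIndex C ↔ NullIndex B := by
  by_cases hB : NullIndex B
  · filter_upwards [hB.eventually] with C hC
    exact iff_of_true hC hB
  · have hcont : Continuous fun C : H →L[ℂ] H => 1 + (C - B) * (1 + S) := by fun_prop
    have hopen : IsOpen {C : H →L[ℂ] H | IsUnit (1 + (C - B) * (1 + S))} :=
      Units.isOpen.preimage hcont
    filter_upwards [hopen.mem_nhds (show IsUnit (1 + (B - B) * (1 + S)) by simp)] with C hC
    refine iff_of_false (fun h => hB (NullIndex.of_parametrix hBS ?_)) hB
    obtain ⟨L, _, _, _, W, G, hG⟩ := h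
    obtain ⟨Y, hY⟩ := isUnit_one_add_dilation W hC
    refine ⟨L, _, _, inferInstance, W, G⁻¹ * Y, ?_⟩
    have h1 : (1 + dilation W C) * (1 + dilation W S) - Y ∈ compactOps L := by
      rw [one_add_dilation_mul, hY, add_sub_add_left_eq_sub, ← dilation_sub]
      convert dilation_mem_compactOps W hBS using 2
      noncomm_ring
    have h2 := mul_left_mem_compactOps (↑G⁻¹ : L →L[ℂ] L) (sub_mem_compactOps h1
      (mul_right_mem_compactOps hG (1 + dilation W S)))
    convert h2 using 1
    rw [Units.val_mul]
    calc _ = (↑G⁻¹ * G) * (1 + dilation W S) - ↑G⁻¹ * Y := by rw [G.inv_mul, one_mul]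
      _ = _ := by noncomm_ring

end NullIndex

/-! ### Direct sums with invertible operators -/

section DirectSum

theorem isUnit_directSumOp {H K : Type} [NormedAddCommGroup H] [InnerProductSpace ℂ H]
    [NormedAddCommGroup K] [InnerProductSpace ℂ K] {S : H →L[ℂ] H} {T : K →L[ℂ] K}
    (hS : IsUnit S) (hT : IsUnit T) : IsUnit (directSumOp S T) := by
  obtain ⟨u, rfl⟩ := hS
  obtain ⟨w, rfl⟩ := hT
  exact ⟨⟨directSumOp u w, directSumOp (↑u⁻¹ : H →L[ℂ] H) (↑w⁻¹ : K →L[ℂ] K),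
    by rw [← directSumOp_mul, u.mul_inv, w.mul_inv, directSumOp_one],
    by rw [← directSumOp_mul, u.inv_mul, w.inv_mul, directSumOp_one]⟩, rfl⟩

variable {H K L : Type} [NormedAddCommGroup H] [InnerProductSpace ℂ H] [CompleteSpace H]
  [NormedAddCommGroup K] [InnerProductSpace ℂ K] [CompleteSpace K]
  [NormedAddCommGroup L] [InnerProductSpace ℂ L] [CompleteSpace L]

/-- The embedding of a Hilbert space as the first summand of a direct sum. -/
def inlIsometry (H K : Type) [NormedAddCommGroup H] [InnerProductSpace ℂ H]
    [NormedAddCommGroup K] [InnerProductSpace ℂ K] : H →ₗᵢ[ℂ] WithLp 2 (H × K) where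
  toFun v := WithLp.toLp 2 (v, 0)
  map_add' v w := by rw [← WithLp.toLp_add]; simp
  map_smul' c v := by rw [← WithLp.toLp_smul]; simp
  norm_map' v := by
    change ‖WithLp.toLp 2 (v, (0 : K))‖ = ‖v‖
    simp

/-- The isometry `W ⊕ 1 : H ⊕ K → L ⊕ K`. -/
def isometryDirectSumId (W : H →ₗᵢ[ℂ] L) (K : Type) [NormedAddCommGroup K]
    [InnerProductSpace ℂ K] : WithLp 2 (H × K) →ₗᵢ[ℂ] WithLp 2 (L × K) where
  toFun v := WithLp.toLp 2 (W v.fst, v.snd)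
  map_add' v w := by simp only [WithLp.add_fst, WithLp.add_snd, map_add]; rfl
  map_smul' c v := by simp only [WithLp.smul_fst, WithLp.smul_snd, map_smul]; rfl
  norm_map' v := by
    change ‖WithLp.toLp 2 (W v.fst, v.snd)‖ = ‖v‖
    simp [WithLp.prod_norm_eq_of_L2]

theorem adjoint_inlIsometry_apply (v : WithLp 2 (H × K)) :
    ContinuousLinearMap.adjoint (inlIsometry H K).toContinuousLinearMap v = v.fst := by
  refine ext_inner_left ℂ fun w => ?_
  rw [ContinuousLinearMap.adjoint_inner_right]
  change inner ℂ (WithLp.toLp 2 (w, (0 : K))) v = _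
  simp

theorem adjoint_isometryDirectSumId_apply (W : H →ₗᵢ[ℂ] L) (v : WithLp 2 (L × K)) :
    ContinuousLinearMap.adjoint (isometryDirectSumId W K).toContinuousLinearMap v =
      WithLp.toLp 2 (ContinuousLinearMap.adjoint W.toContinuousLinearMap v.fst, v.snd) := by
  refine ext_inner_left ℂ fun w => ?_
  rw [ContinuousLinearMap.adjoint_inner_right]
  change inner ℂ (WithLp.toLp 2 (W w.fst, w.snd)) v = _
  simp only [WithLp.prod_inner_apply, ContinuousLinearMap.adjoint_inner_right]
  rfl

theorem dilation_inlIsometry (B : H →L[ℂ] H) :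
    dilation (inlIsometry H K) B = directSumOp B 0 := by
  ext v
  rw [dilation_apply, adjoint_inlIsometry_apply, directSumOp_apply]
  rfl

theorem dilation_isometryDirectSumId (W : H →ₗᵢ[ℂ] L) (B : H →L[ℂ] H) (D : K →L[ℂ] K) :
    dilation (isometryDirectSumId W K) (directSumOp B D) = directSumOp (dilation W B) D := by
  ext v
  rw [dilation_apply, adjoint_isometryDirectSumId_apply, directSumOp_apply, directSumOp_apply]
  rfl

theorem NullIndex.mul_right {B C : H →L[ℂ] H} (h : NullIndex B) (hC : IsUnit (1 + C)) :
    NullIndex (B + C + B * C) := by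
  obtain ⟨L, _, _, _, W, G, hG⟩ := h
  obtain ⟨Y, hY⟩ := isUnit_one_add_dilation W hC
  refine ⟨L, _, _, inferInstance, W, G * Y, ?_⟩
  rw [← one_add_dilation_mul, Units.val_mul, ← hY, ← sub_mul]
  exact mul_right_mem_compactOps hG _

/-- Multiplying $(1+B)\oplus(1+D)$ by $1\oplus(1+D)^{-1}$ leaves $(1+B)\oplus 1$, which is the
stabilization of $1+B$ along the first summand. Conversely $G\oplus(1+D)$ is the required invertible
operator. -/
theorem nullIndex_directSumOp_iff {B : H →L[ℂ] H} {D : K →L[ℂ] K} (hD : IsUnit (1 + D)) :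
    NullIndex (directSumOp B D) ↔ NullIndex B := by
  constructor
  · intro h
    obtain ⟨u, hu⟩ := hD
    have hunit : IsUnit (1 + directSumOp (0 : H →L[ℂ] H) (↑u⁻¹ - 1 : K →L[ℂ] K)) := by
      rw [← directSumOp_one, ← directSumOp_add, add_zero, add_sub_cancel]
      exact isUnit_directSumOp isUnit_one u⁻¹.isUnit
    have h1 := h.mul_right hunit
    have h2 : directSumOp B D + directSumOp (0 : H →L[ℂ] H) (↑u⁻¹ - 1 : K →L[ℂ] K) +
        directSumOp B D * directSumOp (0 : H →L[ℂ] H) (↑u⁻¹ - 1 : K →L[ℂ] K) =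
          dilation (inlIsometry H K) B := by
      have h3 : D + (↑u⁻¹ - 1) + D * (↑u⁻¹ - 1) = 0 := by
        calc _ = (1 + D) * ↑u⁻¹ - 1 := by noncomm_ring
          _ = 0 := by rw [← hu, u.mul_inv, sub_self]
      rw [dilation_inlIsometry, ← directSumOp_mul, ← directSumOp_add, ← directSumOp_add, h3]
      simp
    rw [h2] at h1
    exact h1.of_dilation
  · rintro ⟨L, _, _, _, W, G, hG⟩
    obtain ⟨Y, hY⟩ := isUnit_directSumOp G.isUnit hD
    refine ⟨WithLp 2 (L × K), inferInstance, inferInstance, inferInstance,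
      isometryDirectSumId W K, Y, ?_⟩
    rw [dilation_isometryDirectSumId, hY, ← directSumOp_one, ← directSumOp_add, ← directSumOp_sub,
      sub_self]
    exact directSumOp_compact hG zero_mem_compactOps

end DirectSum

/-! ### The index pairing and its invariance under equivalence of cycles -/

section IndexOperator

variable {A : Type} [NonUnitalCStarAlgebra A]

/-- The operator `½ (F + 1) ρ(a)`, the compression of `ρ(a)` by the essential projection
`½ (F + 1)` up to a compact operator. -/
def indexOperator {H : Type} [NormedAddCommGroup H] [InnerProductSpace ℂ H] [CompleteSpace H]
    (ρ : A →⋆ₙₐ[ℂ] (H →L[ℂ] H)) (F : H →L[ℂ] H) (a : A) : H →L[ℂ] H :=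
  (1 / 2 : ℂ) • ((F + 1) * ρ a)

/-- The hypothesis says $(1+a)(1+b)=1$ in the unitization. The left side measures how far
$1+P\rho(b)$ is from a right inverse of $1+P\rho(a)$, where $P=\frac12(F+1)$. Each term on the right
contains a defect of the cycle, so the error is compact in general and zero in the degenerate case.
-/
theorem indexOperator_quasiMul {H : Type} [NormedAddCommGroup H] [InnerProductSpace ℂ H]
    [CompleteSpace H] (ρ : A →⋆ₙₐ[ℂ] (H →L[ℂ] H)) (F : H →L[ℂ] H) {a b : A}
    (hab : a + b + a * b = 0) :
    indexOperator ρ F a + indexOperator ρ F b + indexOperator ρ F a * indexOperator ρ F b =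
      (1 / 4 : ℂ) • ((F + 1) * (ρ a * F - F * ρ a) * ρ b +
        (F * (F * ρ (a * b) - ρ (a * b) * F) + (F * ρ (a * b) - ρ (a * b) * F) * F +
          ρ (a * b) * (F * F - 1))) := by
  have h : ρ a + ρ b + ρ a * ρ b = 0 := by rw [← map_mul, ← map_add, ← map_add, hab, map_zero]
  have h' : ρ a + ρ b = -(ρ a * ρ b) := eq_neg_of_add_eq_zero_left h
  unfold indexOperator
  rw [← smul_add, ← mul_add, h', map_mul, smul_mul_smul_comm]
  have e1 : (1 / 2 : ℂ) • ((F + 1) * -(ρ a * ρ b)) =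
      (1 / 4 : ℂ) • ((2 : ℂ) • ((F + 1) * -(ρ a * ρ b))) := by
    rw [smul_smul]; norm_num
  rw [e1, show (1 / 2 * (1 / 2) : ℂ) = 1 / 4 by norm_num, ← smul_add, two_smul]
  congr 1
  noncomm_ring

theorem dilation_one_mul_self {H L : Type} [NormedAddCommGroup H] [InnerProductSpace ℂ H]
    [CompleteSpace H] [NormedAddCommGroup L] [InnerProductSpace ℂ L] [CompleteSpace L]
    (V : H →ₗᵢ[ℂ] L) : dilation V 1 * dilation V 1 = dilation V 1 := by
  rw [← dilation_mul, one_mul]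

theorem dilation_compression {H L : Type} [NormedAddCommGroup H] [InnerProductSpace ℂ H]
    [CompleteSpace H] [NormedAddCommGroup L] [InnerProductSpace ℂ L] [CompleteSpace L]
    (V : H →ₗᵢ[ℂ] L) (T : L →L[ℂ] L) :
    dilation V (compression V T) = dilation V 1 * T * dilation V 1 := rfl

/-- Here $P=Q$, and $Q\rho(a)-Q\rho(a)Q=Q[Q,\rho(a)]$ with $[Q,\rho(a)]=\frac12[F,\rho(a)]$ compact.
-/
theorem indexOperator_sub_compression_mem {H : Type} [NormedAddCommGroup H]
    [InnerProductSpace ℂ H] [CompleteSpace H] {ρ : A →⋆ₙₐ[ℂ] (H →L[ℂ] H)} {F Q : H →L[ℂ] H} {a : A}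
    (hcomm : F * ρ a - ρ a * F ∈ compactOps H) (hQ : Q * Q = Q) (hF : F = (2 : ℂ) • Q - 1) :
    indexOperator ρ F a - Q * ρ a * Q ∈ compactOps H := by
  have h1 : indexOperator ρ F a = Q * ρ a := by
    unfold indexOperator
    rw [hF, sub_add_cancel, smul_mul_assoc, smul_smul]
    norm_num
  have h2 : F * ρ a - ρ a * F = (2 : ℂ) • (Q * ρ a - ρ a * Q) := by
    rw [hF, sub_mul, mul_sub, smul_mul_assoc, mul_smul_comm, smul_sub, one_mul, mul_one]
    abel
  have h3 : Q * ρ a - Q * ρ a * Q = Q * ((1 / 2 : ℂ) • (F * ρ a - ρ a * F)) := by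
    rw [h2, smul_smul, mul_smul_comm, mul_sub, ← mul_assoc, hQ, ← mul_assoc]
    norm_num
  rw [h1, h3]
  exact mul_left_mem_compactOps Q (smul_mem_compactOps _ hcomm)

namespace FredholmModule

theorem quasiMul_mem_compactOps (x : FredholmModule A) {a b : A} (hab : a + b + a * b = 0) :
    indexOperator x.rep x.F a + indexOperator x.rep x.F b +
      indexOperator x.rep x.F a * indexOperator x.rep x.F b ∈ compactOps x.H := by
  rw [indexOperator_quasiMul _ _ hab]
  refine smul_mem_compactOps _ (add_mem_compactOps (mul_right_mem_compactOps
    (mul_left_mem_compactOps _ (sub_mem_compactOps_comm (x.comm a))) _) (add_mem_compactOps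
      (add_mem_compactOps (mul_left_mem_compactOps _ (x.comm _))
        (mul_right_mem_compactOps (x.comm _) _)) (x.sq _)))

/-- All error terms of `indexOperator_quasiMul` vanish, so the operator built from $b$ is an exact
two-sided inverse. -/
theorem IsDegenerate.isUnit {x : FredholmModule A} (hx : x.IsDegenerate) {a b : A}
    (hab : a + b + a * b = 0) (hba : b + a + b * a = 0) :
    IsUnit (1 + indexOperator x.rep x.F a) := by
  have key : ∀ a b : A, a + b + a * b = 0 →
      (1 + indexOperator x.rep x.F a) * (1 + indexOperator x.rep x.F b) = 1 := by
    intro a b h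
    have h1 := indexOperator_quasiMul x.rep x.F h
    rw [← neg_sub (x.F * x.rep a), (hx a).1, (hx (a * b)).1, (hx (a * b)).2.1] at h1
    simp only [neg_zero, mul_zero, zero_mul, add_zero, smul_zero] at h1
    calc _ = 1 + (indexOperator x.rep x.F a + indexOperator x.rep x.F b +
          indexOperator x.rep x.F a * indexOperator x.rep x.F b) := by noncomm_ring
      _ = 1 := by rw [h1, add_zero]
  exact ⟨⟨_, _, key a b hab, key b a hba⟩, rfl⟩

/-- Conjugation by $U$ and by $U^{-1}$ are both dilations, and `NullIndex.of_dilation` applies to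
each. -/
theorem UnitarilyEquivalent.nullIndex_iff {x y : FredholmModule A} (h : x.UnitarilyEquivalent y)
    (a : A) :
    NullIndex (indexOperator x.rep x.F a) ↔ NullIndex (indexOperator y.rep y.F a) := by
  obtain ⟨U, hρ, hF⟩ := h
  have h1 : U.conjStarAlgEquiv (indexOperator x.rep x.F a) = indexOperator y.rep y.F a := by
    unfold indexOperator
    rw [map_smul, map_mul, map_add, map_one, hρ, hF]
  have h2 : dilation U.toLinearIsometry (indexOperator x.rep x.F a) =
      indexOperator y.rep y.F a := by
    rw [← h1]
    ext v
    rw [dilation_apply, LinearIsometryEquiv.conjStarAlgEquiv_apply_apply]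
    obtain ⟨w, rfl⟩ := U.surjective v
    rw [U.symm_apply_apply]
    exact congrArg (fun z => U (indexOperator x.rep x.F a z))
      (adjoint_isometry_apply U.toLinearIsometry w)
  have h3 : dilation U.symm.toLinearIsometry (indexOperator y.rep y.F a) =
      indexOperator x.rep x.F a := by
    rw [← h2, ← dilation_comp]
    have : U.symm.toLinearIsometry.comp U.toLinearIsometry = LinearIsometry.id := by
      ext v; simp
    rw [this]
    ext v
    rw [dilation_apply]
    exact congrArg (indexOperator x.rep x.F a) (adjoint_isometry_apply LinearIsometry.id v)
  exact ⟨fun h => by rw [← h3] at h; exact h.of_dilation,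
    fun h => by rw [← h2] at h; exact h.of_dilation⟩

/-- The truth value is locally constant in $t$ by `eventually_nullIndex_iff`, the quasi-inverse $b$
supplying the parametrix, and the interval is connected. -/
theorem OperatorHomotopic.nullIndex_iff {x y : FredholmModule A} (h : x.OperatorHomotopic y)
    {a b : A} (hab : a + b + a * b = 0) :
    NullIndex (indexOperator x.rep x.F a) ↔ NullIndex (indexOperator y.rep y.F a) := by
  obtain ⟨H, _, _, _, _, ρ, F, hcomm, hsq, hself, hF, rfl, rfl⟩ := h
  have hcont : Continuous fun t => indexOperator ρ (F t) a := by
    unfold indexOperator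
    fun_prop
  have hloc : IsLocallyConstant fun t => NullIndex (indexOperator ρ (F t) a) := by
    rw [IsLocallyConstant.iff_eventually_eq]
    intro t
    have h1 := eventually_nullIndex_iff (quasiMul_mem_compactOps
      ⟨H, ρ, F t, hcomm t, hsq t, hself t⟩ hab)
    exact (hcont.continuousAt.eventually h1).mono fun s hs => propext hs
  exact iff_of_eq (hloc.apply_eq_of_isPreconnected isPreconnected_univ (Set.mem_univ 0)
    (Set.mem_univ 1))

theorem nullIndex_directSum_iff (x : FredholmModule A) {d : FredholmModule A}
    (hd : d.IsDegenerate) {a b : A} (hab : a + b + a * b = 0) (hba : b + a + b * a = 0) :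
    NullIndex (indexOperator (x.directSum d).rep (x.directSum d).F a) ↔
      NullIndex (indexOperator x.rep x.F a) := by
  have h : indexOperator (x.directSum d).rep (x.directSum d).F a =
      directSumOp (indexOperator x.rep x.F a) (indexOperator d.rep d.F a) := by
    change (1 / 2 : ℂ) • ((directSumOp x.F d.F + 1) * directSumOp (x.rep a) (d.rep a)) = _
    unfold indexOperator
    rw [directSumOp_smul, directSumOp_mul, directSumOp_add, directSumOp_one]
  rw [h]
  exact nullIndex_directSumOp_iff (hd.isUnit hab hba)

/-- The vanishing of the index pairing with `1 + a`, for `1 + a` invertible, depends only on the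
class of a Fredholm module in `K¹(A)`. -/
theorem KHomologous.nullIndex_iff {x y : FredholmModule A} (h : x.KHomologous y)
    {a b : A} (hab : a + b + a * b = 0) (hba : b + a + b * a = 0) :
    NullIndex (indexOperator x.rep x.F a) ↔ NullIndex (indexOperator y.rep y.F a) := by
  induction h with
  | rel x y h =>
    rcases h with h | h | ⟨d, hd, rfl⟩
    · exact h.nullIndex_iff a
    · exact h.nullIndex_iff hab
    · exact (nullIndex_directSum_iff x hd hab hba).symm
  | refl x => rfl
  | symm x y _ ih => exact ih.symm
  | trans x y z _ _ ih ih' => exact ih.trans ih'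

end FredholmModule

namespace CompactExtension

variable {H : Type} [NormedAddCommGroup H] [InnerProductSpace ℂ H] [CompleteSpace H]

theorem Lifts.sub_mem_compactOps {e : CompactExtension A H} {S T : H →L[ℂ] H} {a : A}
    (hS : e.Lifts S a) (hT : e.Lifts T a) : S - T ∈ compactOps H := by
  obtain ⟨hS, rfl⟩ := hS
  obtain ⟨hT, h⟩ := hT
  refine (e.ker (⟨S, hS⟩ - ⟨T, hT⟩)).1 ?_
  rw [map_sub, h, sub_self]

theorem Lifts.sub {e : CompactExtension A H} {S T : H →L[ℂ] H} {a b : A}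
    (hS : e.Lifts S a) (hT : e.Lifts T b) : e.Lifts (S - T) (a - b) := by
  obtain ⟨hS, rfl⟩ := hS
  obtain ⟨hT, rfl⟩ := hT
  exact ⟨sub_mem hS hT, map_sub e.quot ⟨S, hS⟩ ⟨T, hT⟩⟩

/-- This links cycles to extensions: two lifts of $a$ differ by a compact operator, so any
convenient lift $R$ computes the index for every representing cycle and every isometry $V$. -/
theorem RepresentedVia.indexOperator_sub_mem {e : CompactExtension A H} {x : FredholmModule A}
    {V : H →ₗᵢ[ℂ] x.H} (h : e.RepresentedVia x V) {R : H →L[ℂ] H} {a : A} (hR : e.Lifts R a) :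
    indexOperator x.rep x.F a - dilation V R ∈ compactOps x.H := by
  obtain ⟨hF, hlift⟩ := h
  have h1 : compression V (x.rep a) - R ∈ compactOps H := (hlift a).sub_mem_compactOps hR
  have h2 := add_mem_compactOps
    (indexOperator_sub_compression_mem (x.comm a) (dilation_one_mul_self V) hF)
    (dilation_mem_compactOps V h1)
  rw [dilation_sub, dilation_compression] at h2
  convert h2 using 1
  abel

end CompactExtension

end IndexOperator

/-! ### Compact operators on $\ell^2$ and matrix units -/

section Ell2

open Filter Topology InnerProductSpace

variable {X Y : Type} {H : Type} [NormedAddCommGroup H] [InnerProductSpace ℂ H]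

theorem ell2Delta_apply_self (x : X) : (ell2Delta x : X → ℂ) x = 1 := by
  classical
  unfold ell2Delta
  rw [lp.single_apply_self]

theorem ell2Delta_apply_ne {x y : X} (h : y ≠ x) : (ell2Delta x : X → ℂ) y = 0 := by
  classical
  unfold ell2Delta
  rw [lp.single_apply_ne _ _ _ h]

theorem inner_ell2Delta_left (x : X) (f : Ell2 X) : inner ℂ (ell2Delta x) f = f x := by
  classical
  unfold ell2Delta
  rw [lp.inner_single_left]
  simp

theorem inner_ell2Delta_right (x : X) (f : Ell2 X) :
    inner ℂ f (ell2Delta x) = (starRingEnd ℂ) (f x) := by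
  rw [← inner_conj_symm, inner_ell2Delta_left]

theorem norm_ell2Delta (x : X) : ‖ell2Delta x‖ = 1 := by
  classical
  unfold ell2Delta
  rw [lp.norm_single (by norm_num)]
  simp

theorem single_eq_smul_ell2Delta [DecidableEq X] (x : X) (c : ℂ) :
    (lp.single 2 x c : Ell2 X) = c • ell2Delta x := by
  ext y
  by_cases h : y = x
  · subst h
    simp [ell2Delta_apply_self]
  · rw [lp.single_apply_ne _ _ _ h]
    simp [ell2Delta_apply_ne h]

theorem orthonormal_ell2Delta_comp {g : X → Y} (hg : Function.Injective g) :
    Orthonormal ℂ fun x => ell2Delta (g x) := by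
  refine ⟨fun x => norm_ell2Delta _, fun x y hxy => ?_⟩
  change inner ℂ (ell2Delta (g x)) (ell2Delta (g y)) = 0
  rw [inner_ell2Delta_left]
  exact ell2Delta_apply_ne (hg.ne hxy)

theorem hasSum_ell2Delta (f : Ell2 X) : HasSum (fun x => f x • ell2Delta x) f := by
  classical
  simpa only [single_eq_smul_ell2Delta] using lp.hasSum_single (p := 2) (by norm_num) f

theorem ell2_induction {p : Submodule ℂ (Ell2 X)} (hp : IsClosed (p : Set (Ell2 X)))
    (h : ∀ x, ell2Delta x ∈ p) (f : Ell2 X) : f ∈ p :=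
  hp.mem_of_tendsto (hasSum_ell2Delta f)
    (Eventually.of_forall fun _ => p.sum_mem fun x _ => p.smul_mem _ (h x))

theorem ell2_clm_ext {S T : Ell2 X →L[ℂ] H} (h : ∀ x, S (ell2Delta x) = T (ell2Delta x)) :
    S = T := by
  ext1 f
  refine (S.hasSum (hasSum_ell2Delta f)).unique ?_
  convert T.hasSum (hasSum_ell2Delta f) using 2 with x
  simp [h]

theorem tendsto_ell2_cofinite (f : Ell2 X) : Tendsto (fun x => ‖f x‖) cofinite (𝓝 0) := by
  have h1 : Summable fun x => ‖f x‖ ^ 2 := by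
    have := (lp.memℓp f).summable (by norm_num)
    simpa using this
  have h2 := h1.tendsto_cofinite_zero.sqrt
  simpa [Real.sqrt_sq (norm_nonneg _)] using h2

theorem norm_sub_sum_ell2Delta_le (f : Ell2 X) (s : Finset X) :
    ‖f - ∑ x ∈ s, f x • ell2Delta x‖ ≤ ‖f‖ := by
  classical
  have h := lp.norm_compl_sum_single (p := 2) (by norm_num) f s
  simp only [single_eq_smul_ell2Delta] at h
  have h2 : 0 ≤ ∑ i ∈ s, ‖f i‖ ^ (2 : ℝ≥0∞).toReal := Finset.sum_nonneg fun _ _ => by positivity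
  have h3 : ‖f - ∑ x ∈ s, f x • ell2Delta x‖ ^ (2 : ℝ≥0∞).toReal ≤ ‖f‖ ^ (2 : ℝ≥0∞).toReal := by
    rw [h]; linarith
  exact (Real.rpow_le_rpow_iff (norm_nonneg _) (norm_nonneg _) (by norm_num)).1 h3

theorem rankOne_isCompactOperator {E : Type} [NormedAddCommGroup E] [InnerProductSpace ℂ E]
    (u : H) (v : E) : IsCompactOperator (rankOne ℂ u v) := by
  have h : IsCompactOperator (innerSL ℂ v : E →L[ℂ] ℂ) :=
    isCompactOperator_of_locallyCompactSpace_dom (innerSL ℂ v)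
  exact h.clm_comp (ContinuousLinearMap.toSpanSingleton ℂ u)

theorem sum_rankOne_isCompactOperator {ι E : Type} [NormedAddCommGroup E] [InnerProductSpace ℂ E]
    (u : ι → H) (v : ι → E) (s : Finset ι) :
    IsCompactOperator (∑ i ∈ s, rankOne ℂ (u i) (v i) : E →L[ℂ] H) :=
  (compactOperator (RingHom.id ℂ) E H).sum_mem fun i _ => rankOne_isCompactOperator (u i) (v i)

/-- Such an operator is the finite sum of the rank-one operators given by its nonzero columns. -/
theorem isCompactOperator_of_finite_support (T : Ell2 X →L[ℂ] H) (s : Set X) (hs : s.Finite)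
    (h : ∀ x ∉ s, T (ell2Delta x) = 0) : IsCompactOperator T := by
  have : T = ∑ x ∈ hs.toFinset, rankOne ℂ (T (ell2Delta x)) (ell2Delta x) := by
    refine ell2_clm_ext fun y => ?_
    rw [sum_apply]
    simp only [rankOne_apply, inner_ell2Delta_left]
    by_cases hy : y ∈ s
    · rw [Finset.sum_eq_single y]
      · rw [ell2Delta_apply_self, one_smul]
      · intro x _ hxy
        rw [ell2Delta_apply_ne hxy, zero_smul]
      · simp [hy]
    · rw [h y hy, Finset.sum_eq_zero]
      intro x hx
      have hxy : x ≠ y := by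
        rintro rfl
        exact hy (hs.mem_toFinset.1 hx)
      rw [ell2Delta_apply_ne hxy, zero_smul]
  rw [this]
  exact sum_rankOne_isCompactOperator _ _ _

/-- The sum is the truncation of $T$ to the coordinates in $s$. Some $s$ works for a finite
$\varepsilon/2$-net of the image of the unit ball, and truncation errors do not exceed norms, which
takes care of the distance to the net. -/
theorem exists_finset_norm_sub_sum_rankOne_le [CompleteSpace H] {T : H →L[ℂ] Ell2 X}
    (hT : IsCompactOperator T) {ε : ℝ} (hε : 0 < ε) :
    ∃ s : Finset X,
      ‖T - ∑ x ∈ s, rankOne ℂ (ell2Delta x) (ContinuousLinearMap.adjoint T (ell2Delta x))‖ ≤ ε := by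
  have htb := (hT.isCompact_closure_image_closedBall 1).totallyBounded
  obtain ⟨t, ht, htc⟩ := Metric.totallyBounded_iff.1 htb (ε / 2) (by positivity)
  have hev : ∀ᶠ s : Finset X in atTop, ∀ y ∈ t, ‖y - ∑ x ∈ s, y x • ell2Delta x‖ < ε / 2 := by
    rw [eventually_all_finite ht]
    intro y _
    have := Metric.tendsto_nhds.1 (hasSum_ell2Delta y) (ε / 2) (by positivity)
    filter_upwards [this] with s hs
    rwa [dist_comm, dist_eq_norm] at hs
  obtain ⟨s, hs⟩ := hev.exists
  refine ⟨s, ContinuousLinearMap.opNorm_le_of_unit_norm hε.le fun v hv => ?_⟩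
  have hmem : T v ∈ closure (T '' Metric.closedBall 0 1) :=
    subset_closure ⟨v, by simp [hv], rfl⟩
  obtain ⟨y, hy, hvy⟩ := Set.mem_iUnion₂.1 (htc hmem)
  have e : (T - ∑ x ∈ s, rankOne ℂ (ell2Delta x)
      (ContinuousLinearMap.adjoint T (ell2Delta x))) v =
      T v - ∑ x ∈ s, (T v : X → ℂ) x • ell2Delta x := by
    rw [sub_apply, sum_apply]
    simp only [rankOne_apply, ContinuousLinearMap.adjoint_inner_left, inner_ell2Delta_left]
  have e2 : T v - ∑ x ∈ s, (T v : X → ℂ) x • ell2Delta x =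
      ((T v - y) - ∑ x ∈ s, (T v - y : Ell2 X) x • ell2Delta x) +
        (y - ∑ x ∈ s, y x • ell2Delta x) := by
    simp only [lp.coeFn_sub, Pi.sub_apply, sub_smul, Finset.sum_sub_distrib]
    abel
  rw [e, e2]
  refine (norm_add_le _ _).trans ?_
  have h1 := norm_sub_sum_ell2Delta_le (T v - y) s
  rw [Metric.mem_ball, dist_eq_norm] at hvy
  linarith [hs y hy]

theorem isClosed_compactOps [CompleteSpace H] : IsClosed (compactOps H) :=
  isClosed_setOfPred_isCompactOperator

/-- The adjoint is an isometry that preserves finite-rank operators, and these approximate $T$ in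
norm. -/
theorem adjoint_mem_compactOps {T : Ell2 X →L[ℂ] Ell2 X} (hT : T ∈ compactOps (Ell2 X)) :
    star T ∈ compactOps (Ell2 X) := by
  rw [← isClosed_compactOps.closure_eq, Metric.mem_closure_iff]
  intro ε hε
  obtain ⟨s, hs⟩ := exists_finset_norm_sub_sum_rankOne_le hT (half_pos hε)
  refine ⟨∑ x ∈ s, rankOne ℂ (ContinuousLinearMap.adjoint T (ell2Delta x)) (ell2Delta x),
    sum_rankOne_isCompactOperator _ _ _, ?_⟩
  rw [dist_eq_norm, ← norm_star]
  have : star (star T - ∑ x ∈ s,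
      rankOne ℂ (ContinuousLinearMap.adjoint T (ell2Delta x)) (ell2Delta x)) =
      T - ∑ x ∈ s, rankOne ℂ (ell2Delta x) (ContinuousLinearMap.adjoint T (ell2Delta x)) := by
    rw [star_sub, star_star, star_sum]
    simp [ContinuousLinearMap.star_eq_adjoint]
  rw [this]
  linarith

/-- On a finite-rank truncation the value at $\delta_x$ is controlled by the $x$-th coordinates of
finitely many fixed vectors, which tend to $0$. -/
theorem tendsto_compact_ell2Delta {T : Ell2 X →L[ℂ] Ell2 Y} (hT : IsCompactOperator T) :
    Tendsto (fun x => ‖T (ell2Delta x)‖) cofinite (𝓝 0) := by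
  rw [Metric.tendsto_nhds]
  intro ε hε
  obtain ⟨s, hs⟩ := exists_finset_norm_sub_sum_rankOne_le hT (half_pos hε)
  set R := ∑ y ∈ s, rankOne ℂ (ell2Delta y) (ContinuousLinearMap.adjoint T (ell2Delta y)) with hR
  have h1 : Tendsto (fun x => ∑ y ∈ s, ‖(ContinuousLinearMap.adjoint T (ell2Delta y) : X → ℂ) x‖)
      cofinite (𝓝 0) := by
    simpa using tendsto_finsetSum s fun y _ =>
      tendsto_ell2_cofinite (ContinuousLinearMap.adjoint T (ell2Delta y))
  filter_upwards [h1.eventually (gt_mem_nhds (half_pos hε))] with x hx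
  rw [dist_zero_right, norm_norm]
  have h2 : ‖R (ell2Delta x)‖ ≤
      ∑ y ∈ s, ‖(ContinuousLinearMap.adjoint T (ell2Delta y) : X → ℂ) x‖ := by
    rw [hR, sum_apply]
    refine norm_sum_le_of_le _ fun y _ => ?_
    rw [rankOne_apply, norm_smul, norm_ell2Delta, mul_one, inner_ell2Delta_right, RCLike.norm_conj]
  have h3 : ‖(T - R) (ell2Delta x)‖ ≤ ε / 2 := by
    refine ((T - R).le_opNorm _).trans ?_
    rw [norm_ell2Delta, mul_one]
    exact hs
  have h4 : T (ell2Delta x) = (T - R) (ell2Delta x) + R (ell2Delta x) := by simp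
  rw [h4]
  linarith [norm_add_le ((T - R) (ell2Delta x)) (R (ell2Delta x))]

/-- A closed `*`-subalgebra of `B(ℓ²(X))` which contains a projection onto the line spanned by
some `δ_o`, and whose elements move `δ_o` to every `δ_x`, contains the compact operators. -/
theorem compactOps_subset_of_rankOne_mem (G : NonUnitalStarSubalgebra ℂ (Ell2 X →L[ℂ] Ell2 X))
    (hG : IsClosed (G : Set (Ell2 X →L[ℂ] Ell2 X))) (o : X)
    (ho : rankOne ℂ (ell2Delta o) (ell2Delta o) ∈ G)
    (hmove : ∀ x, ∃ S ∈ G, S (ell2Delta o) = ell2Delta x) :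
    compactOps (Ell2 X) ⊆ G := by
  have h1 : ∀ x, rankOne ℂ (ell2Delta x) (ell2Delta o) ∈ G := by
    intro x
    obtain ⟨S, hS, hSx⟩ := hmove x
    rw [← hSx, ← comp_rankOne]
    exact mul_mem hS ho
  have h2 : ∀ x y : X, rankOne ℂ (ell2Delta x) (ell2Delta y) ∈ G := by
    intro x y
    have h3 := mul_mem (h1 x) (star_mem (h1 y))
    rw [ContinuousLinearMap.star_eq_adjoint, adjoint_rankOne, ContinuousLinearMap.mul_def,
      rankOne_comp_rankOne, inner_ell2Delta_left, ell2Delta_apply_self, one_smul] at h3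
    exact h3
  have h3 : ∀ (x : X) (v : Ell2 X), rankOne ℂ (ell2Delta x) v ∈ G := by
    intro x v
    -- The operator is continuous and conjugate-linear in $v$, so $v$ is expanded in the basis.
    refine hG.mem_of_tendsto (((rankOne ℂ (ell2Delta x)).hasSum (hasSum_ell2Delta v)))
      (Eventually.of_forall fun s => ?_)
    refine sum_mem fun y _ => ?_
    rw [map_smulₛₗ]
    exact SMulMemClass.smul_mem _ (h2 x y)
  intro T hT
  rw [← hG.closure_eq, Metric.mem_closure_iff]
  intro ε hε
  obtain ⟨s, hs⟩ := exists_finset_norm_sub_sum_rankOne_le hT (half_pos hε)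
  refine ⟨∑ x ∈ s, rankOne ℂ (ell2Delta x) (ContinuousLinearMap.adjoint T (ell2Delta x)),
    sum_mem fun x _ => h3 x _, ?_⟩
  rw [dist_eq_norm]
  exact hs.trans_lt (half_lt_self hε)

/-- The isometry `ℓ²(X) → ℓ²(Y)` induced by an injection `X → Y`. -/
def ell2Isometry (g : X → Y) (hg : Function.Injective g) : Ell2 X →ₗᵢ[ℂ] Ell2 Y :=
  (orthonormal_ell2Delta_comp hg).orthogonalFamily.linearIsometry

theorem ell2Isometry_delta (g : X → Y) (hg : Function.Injective g) (x : X) :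
    ell2Isometry g hg (ell2Delta x) = ell2Delta (g x) := by
  classical
  have := (orthonormal_ell2Delta_comp hg).orthogonalFamily.linearIsometry_apply_single (i := x)
    (1 : ℂ)
  rw [single_eq_smul_ell2Delta, one_smul] at this
  rw [ell2Isometry, this]
  simp

theorem adjoint_ell2Isometry_delta (g : X → Y) (hg : Function.Injective g) (x : X) :
    ContinuousLinearMap.adjoint (ell2Isometry g hg).toContinuousLinearMap (ell2Delta (g x)) =
      ell2Delta x := by
  rw [← ell2Isometry_delta g hg]
  exact adjoint_isometry_apply _ _

theorem adjoint_ell2Isometry_delta_of_notMem_range (g : X → Y) (hg : Function.Injective g) {y : Y}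
    (hy : y ∉ Set.range g) :
    ContinuousLinearMap.adjoint (ell2Isometry g hg).toContinuousLinearMap (ell2Delta y) = 0 := by
  ext x
  rw [← inner_ell2Delta_left, ContinuousLinearMap.adjoint_inner_right]
  change inner ℂ (ell2Isometry g hg (ell2Delta x)) _ = _
  rw [ell2Isometry_delta, inner_ell2Delta_left]
  exact ell2Delta_apply_ne fun h => hy ⟨x, h⟩

theorem ell2Isometry_surjective (g : X → Y) (hg : Function.Bijective g) :
    Function.Surjective (ell2Isometry g hg.1) := by
  intro f
  refine ell2_induction (p := LinearMap.range (ell2Isometry g hg.1).toLinearMap) ?_ (fun y => ?_) f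
  · exact (ell2Isometry g hg.1).isometry.isClosedEmbedding.isClosed_range
  · obtain ⟨x, rfl⟩ := hg.2 y
    exact ⟨ell2Delta x, ell2Isometry_delta g hg.1 x⟩

end Ell2

/-! ### Generated $C^*$-algebras -/

section GeneratedAlgebra

variable {H : Type} [NormedAddCommGroup H] [InnerProductSpace ℂ H] [CompleteSpace H]

theorem subset_generatedCStarAlgebra (S : Set (H →L[ℂ] H)) :
    S ⊆ (generatedCStarAlgebra S : Set (H →L[ℂ] H)) :=
  (NonUnitalStarAlgebra.subset_adjoin ℂ S).trans
    (NonUnitalStarSubalgebra.le_topologicalClosure _)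

theorem isClosed_generatedCStarAlgebra (S : Set (H →L[ℂ] H)) :
    IsClosed (generatedCStarAlgebra S : Set (H →L[ℂ] H)) :=
  NonUnitalStarSubalgebra.isClosed_topologicalClosure _

theorem generatedCStarAlgebra_le {S : Set (H →L[ℂ] H)}
    {G : NonUnitalStarSubalgebra ℂ (H →L[ℂ] H)} (hG : IsClosed (G : Set (H →L[ℂ] H)))
    (hS : S ⊆ G) : generatedCStarAlgebra S ≤ G :=
  NonUnitalStarSubalgebra.topologicalClosure_minimal _ (NonUnitalStarAlgebra.adjoin_le hS) hG

end GeneratedAlgebra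

/-! ### The isomorphism of $C(S^1)$ with $C^*_\rho(\mathbb Z)$ -/

section RegularRepresentation

open Filter Topology

theorem rightTranslation_delta (n j : ℤ) :
    rightTranslation n (ell2Delta j) = ell2Delta (j + n) :=
  inducedOperator_delta_of_eq_some _ rfl

theorem rightTranslation_zero : rightTranslation 0 = 1 :=
  ell2_clm_ext fun j => by rw [rightTranslation_delta, add_zero]; rfl

theorem rightTranslation_mul (m n : ℤ) :
    rightTranslation m * rightTranslation n = rightTranslation (m + n) :=
  ell2_clm_ext fun j => by
    rw [mul_apply_eq_comp, rightTranslation_delta, rightTranslation_delta, rightTranslation_delta,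
      add_assoc, add_comm n]

theorem star_rightTranslation (n : ℤ) : star (rightTranslation n) = rightTranslation (-n) := by
  refine ell2_clm_ext fun j => ?_
  ext i
  rw [← inner_ell2Delta_left, ContinuousLinearMap.star_eq_adjoint,
    ContinuousLinearMap.adjoint_inner_right, rightTranslation_delta, rightTranslation_delta,
    inner_ell2Delta_left]
  by_cases h : i = j + -n
  · have : j = i + n := by omega
    rw [h, ell2Delta_apply_self, neg_add_cancel_right, ell2Delta_apply_self]
  · rw [ell2Delta_apply_ne h, ell2Delta_apply_ne (by omega)]

theorem norm_rightTranslation_apply (n : ℤ) (f : Ell2 ℤ) : ‖rightTranslation n f‖ = ‖f‖ := by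
  have h : star (rightTranslation n) * rightTranslation n = 1 := by
    rw [star_rightTranslation, rightTranslation_mul, neg_add_cancel, rightTranslation_zero]
  have h2 : inner ℂ (rightTranslation n f) (rightTranslation n f) = inner ℂ f f := by
    rw [← ContinuousLinearMap.adjoint_inner_right, ← ContinuousLinearMap.star_eq_adjoint,
      ← mul_apply_eq_comp, h]
    rfl
  rw [@norm_eq_sqrt_re_inner ℂ, h2, ← @norm_eq_sqrt_re_inner ℂ]

theorem rightTranslation_mem_unitary (n : ℤ) : rightTranslation n ∈ unitary _ := by
  rw [Unitary.mem_iff, star_rightTranslation, rightTranslation_mul, rightTranslation_mul,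
    neg_add_cancel, add_neg_cancel, rightTranslation_zero]
  exact ⟨rfl, rfl⟩

instance rightTranslation_isStarNormal (n : ℤ) : IsStarNormal (rightTranslation n) :=
  ⟨by rw [star_rightTranslation, Commute, SemiconjBy, rightTranslation_mul, rightTranslation_mul,
    add_comm]⟩

/-- A square summable function whose modulus is constant along infinitely many distinct points
vanishes there. -/
theorem eq_zero_of_norm_succ_eq {f : Ell2 ℤ} {g : ℕ → ℤ} (hg : Function.Injective g)
    (h : ∀ n, ‖f (g (n + 1))‖ = ‖f (g n)‖) : f (g 0) = 0 := by
  have hconst : ∀ n, ‖f (g n)‖ = ‖f (g 0)‖ := fun n => by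
    induction n with
    | zero => rfl
    | succ n ih => rw [h, ih]
  have h1 := (tendsto_ell2_cofinite f).comp hg.tendsto_cofinite
  have h2 : ((fun x => ‖f x‖) ∘ g) = fun _ => ‖f (g 0)‖ := funext hconst
  rw [h2] at h1
  exact norm_eq_zero.1 (tendsto_nhds_unique tendsto_const_nhds h1)

/-- The spectrum of the bilateral shift is the whole unit circle: for `|λ| = 1` the equation
`(λ - ρ₁) v = δ₀` has no solution in `ℓ²(ℤ)`. -/
theorem circle_mem_spectrum_rightTranslation (w : Circle) :
    (w : ℂ) ∈ spectrum ℂ (rightTranslation 1) := by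
  intro hunit
  obtain ⟨u, hu⟩ := hunit
  set v := (↑u⁻¹ : Ell2 ℤ →L[ℂ] Ell2 ℤ) (ell2Delta 0) with hv
  have h1 : (u : Ell2 ℤ →L[ℂ] Ell2 ℤ) v = ell2Delta 0 := by
    rw [hv, ← mul_apply_eq_comp, u.mul_inv]; rfl
  have h2 : ∀ j : ℤ, (w : ℂ) * v j - v (j - 1) = (ell2Delta (0 : ℤ) : ℤ → ℂ) j := by
    intro j
    rw [← h1, hu, Algebra.algebraMap_eq_smul_one]
    rfl
  -- Off $0$ the equation forces constant modulus on $j\ge 0$ and on $j\le -1$ separately, so $v$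
  -- vanishes at $0$ and $-1$, contradicting the equation at $j=0$.
  have h3 : ∀ j : ℤ, j ≠ 0 → ‖v (j - 1)‖ = ‖v j‖ := by
    intro j hj
    have := h2 j
    rw [ell2Delta_apply_ne hj, sub_eq_zero] at this
    rw [← this, norm_mul, Circle.norm_coe, one_mul]
  have h4 : v 0 = 0 := by
    refine eq_zero_of_norm_succ_eq (g := fun n : ℕ => (n : ℤ)) Nat.cast_injective fun n => ?_
    rw [← h3 _ (by omega)]
    simp
  have h5 : v (-1) = 0 := by
    refine eq_zero_of_norm_succ_eq (g := fun n : ℕ => -1 - (n : ℤ))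
      (fun m n h => by simpa using h) fun n => ?_
    rw [show -1 - ((n + 1 : ℕ) : ℤ) = -1 - (n : ℤ) - 1 by push_cast; ring]
    exact h3 _ (by omega)
  have h6 := h2 0
  rw [zero_sub, h4, h5, ell2Delta_apply_self] at h6
  simp at h6

/-- The inclusion of the spectrum of the bilateral shift in the circle. -/
def spectrumToCircle : C(spectrum ℂ (rightTranslation 1), Circle) where
  toFun z := ⟨z, spectrum.subset_circle_of_unitary (rightTranslation_mem_unitary 1) z.2⟩
  continuous_toFun := continuous_subtype_val.subtype_mk _

theorem spectrumToCircle_surjective : Function.Surjective spectrumToCircle :=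
  fun w => ⟨⟨w, circle_mem_spectrum_rightTranslation w⟩, rfl⟩

/-- The representation of `C(S¹)` on `ℓ²(ℤ)` which sends `z` to the bilateral shift. -/
def circleRep : C(Circle, ℂ) →⋆ₐ[ℂ] (Ell2 ℤ →L[ℂ] Ell2 ℤ) :=
  (cfcHom (R := ℂ) (rightTranslation_isStarNormal 1)).comp
    (ContinuousMap.compStarAlgHom' ℂ ℂ spectrumToCircle)

/-- The spectrum of the shift is the full circle, so restricting a function to it loses nothing. -/
theorem circleRep_injective : Function.Injective circleRep := by
  refine (cfcHom_injective (R := ℂ) (rightTranslation_isStarNormal 1)).comp fun f g h => ?_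
  ext w
  obtain ⟨z, rfl⟩ := spectrumToCircle_surjective w
  exact DFunLike.congr_fun h z

theorem circleRep_isometry : Isometry circleRep :=
  NonUnitalStarAlgHom.isometry circleRep circleRep_injective

theorem norm_circleRep (f : C(Circle, ℂ)) : ‖circleRep f‖ = ‖f‖ :=
  circleRep_isometry.norm_map_of_map_zero (map_zero _) f

theorem circlePow_zero : circlePow 0 = 1 := by
  ext w
  simp [circlePow]

theorem circlePow_add (m n : ℤ) : circlePow (m + n) = circlePow m * circlePow n := by
  ext w
  simp [circlePow, zpow_add]

theorem circleRep_circlePow_one : circleRep (circlePow 1) = rightTranslation 1 := by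
  have h : circlePow 1 = ⟨fun w => (w : ℂ), continuous_subtype_val⟩ := by
    ext w
    exact congrArg Subtype.val (zpow_one w)
  rw [h]
  exact cfcHom_id (R := ℂ) (rightTranslation_isStarNormal 1)

theorem circleRep_circlePow (n : ℤ) : circleRep (circlePow n) = rightTranslation n := by
  let φ : Multiplicative ℤ →* (Ell2 ℤ →L[ℂ] Ell2 ℤ) :=
    { toFun := fun n => circleRep (circlePow n.toAdd)
      map_one' := by rw [toAdd_one, circlePow_zero, map_one]
      map_mul' := fun m n => by rw [toAdd_mul, circlePow_add, map_mul] }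
  let ψ : Multiplicative ℤ →* (Ell2 ℤ →L[ℂ] Ell2 ℤ) :=
    { toFun := fun n => rightTranslation n.toAdd
      map_one' := rightTranslation_zero
      map_mul' := fun m n => by rw [toAdd_mul, rightTranslation_mul] }
  have : φ = ψ := MonoidHom.ext_mint circleRep_circlePow_one
  exact DFunLike.congr_fun this (Multiplicative.ofAdd n)

/-- The functional calculus stays in the closed unital $*$-algebra generated by $\rho_1$. -/
theorem circleRep_mem (f : C(Circle, ℂ)) : circleRep f ∈ reducedGroupAlgebra := by
  have hmem : ∀ n, rightTranslation n ∈ reducedGroupAlgebra := fun n =>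
    subset_generatedCStarAlgebra _ ⟨n, rfl⟩
  have h1 : (1 : Ell2 ℤ →L[ℂ] Ell2 ℤ) ∈ reducedGroupAlgebra := by
    rw [← rightTranslation_zero]
    exact hmem 0
  have h2 : StarAlgebra.elemental ℂ (rightTranslation 1) ≤
      reducedGroupAlgebra.toStarSubalgebra h1 :=
    StarAlgebra.elemental.le_of_mem (isClosed_generatedCStarAlgebra _) (hmem 1)
  exact h2 (cfcHom_mem_elemental _ _)

/-- An isometric $*$-homomorphism has closed range, and this range contains the generators $\rho_n$.
-/
theorem exists_circleRep_eq {T : Ell2 ℤ →L[ℂ] Ell2 ℤ} (hT : T ∈ reducedGroupAlgebra) :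
    ∃ f, circleRep f = T := by
  have h : reducedGroupAlgebra ≤
      NonUnitalStarAlgHom.range (circleRep : C(Circle, ℂ) →⋆ₙₐ[ℂ] (Ell2 ℤ →L[ℂ] Ell2 ℤ)) := by
    refine generatedCStarAlgebra_le circleRep_isometry.isClosedEmbedding.isClosed_range ?_
    rintro _ ⟨n, rfl⟩
    exact ⟨circlePow n, circleRep_circlePow n⟩
  exact h hT

/-- The identification of `C(S¹)` with `C*_ρ(ℤ)`. -/
def circleEquiv : C(Circle, ℂ) ≃⋆ₐ[ℂ] reducedGroupAlgebra :=
  StarAlgEquiv.ofBijective (NonUnitalStarAlgHom.codRestrict circleRep reducedGroupAlgebra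
    circleRep_mem) ⟨fun _ _ h => circleRep_injective (congrArg Subtype.val h), fun T => by
      obtain ⟨f, hf⟩ := exists_circleRep_eq T.2
      exact ⟨f, Subtype.ext hf⟩⟩

theorem regularRep_circleEquiv (f : C(Circle, ℂ)) : regularRep circleEquiv f = circleRep f := rfl

end RegularRepresentation

/-! ### Algebra of compressions -/

section Compression

variable {H L : Type} [NormedAddCommGroup H] [InnerProductSpace ℂ H] [CompleteSpace H]
  [NormedAddCommGroup L] [InnerProductSpace ℂ L] [CompleteSpace L]

theorem compression_add (V : H →ₗᵢ[ℂ] L) (S T : L →L[ℂ] L) :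
    compression V (S + T) = compression V S + compression V T := by
  ext v; simp [compression_apply]

theorem compression_sub (V : H →ₗᵢ[ℂ] L) (S T : L →L[ℂ] L) :
    compression V (S - T) = compression V S - compression V T := by
  ext v; simp [compression_apply]

theorem compression_smul (V : H →ₗᵢ[ℂ] L) (c : ℂ) (T : L →L[ℂ] L) :
    compression V (c • T) = c • compression V T := by
  ext v; simp [compression_apply]

theorem compression_zero (V : H →ₗᵢ[ℂ] L) : compression V 0 = 0 := by
  ext v; simp [compression_apply]

theorem compression_one (V : H →ₗᵢ[ℂ] L) : compression V 1 = 1 := by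
  ext v; exact adjoint_isometry_apply V v

theorem star_compression (V : H →ₗᵢ[ℂ] L) (T : L →L[ℂ] L) :
    star (compression V T) = compression V (star T) := by
  simp only [compression, ContinuousLinearMap.star_eq_adjoint, ContinuousLinearMap.adjoint_comp,
    ContinuousLinearMap.adjoint_adjoint]
  rfl

theorem star_dilation (V : H →ₗᵢ[ℂ] L) (T : H →L[ℂ] H) :
    star (dilation V T) = dilation V (star T) := by
  simp only [dilation, ContinuousLinearMap.star_eq_adjoint, ContinuousLinearMap.adjoint_comp,
    ContinuousLinearMap.adjoint_adjoint]
  rfl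

/-- The failure of compression to be multiplicative is governed by the commutator of $T$ with the
range projection $VV^*$; if that is compact, so is the defect. -/
theorem compression_mul_sub (V : H →ₗᵢ[ℂ] L) (S T : L →L[ℂ] L) :
    compression V (S * T) - compression V S * compression V T =
      compression V (S * (T * dilation V 1 - dilation V 1 * T)) := by
  ext v
  simp [compression_apply, dilation_apply, adjoint_isometry_apply]

theorem continuous_compression (V : H →ₗᵢ[ℂ] L) : Continuous (compression V) := by
  unfold compression
  fun_prop

theorem norm_adjoint_isometry_apply_le (V : H →ₗᵢ[ℂ] L) (v : L) :
    ‖ContinuousLinearMap.adjoint V.toContinuousLinearMap v‖ ≤ ‖v‖ := by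
  have h := (ContinuousLinearMap.adjoint V.toContinuousLinearMap).le_opNorm v
  rw [LinearIsometryEquiv.norm_map] at h
  exact h.trans (mul_le_of_le_one_left (norm_nonneg _) V.norm_toContinuousLinearMap_le)

theorem norm_dilation_apply_le (V : H →ₗᵢ[ℂ] L) (T : H →L[ℂ] H) (v : L) :
    ‖dilation V T v‖ ≤ ‖T‖ * ‖v‖ := by
  rw [dilation_apply, V.norm_map]
  exact (T.le_opNorm _).trans
    (mul_le_mul_of_nonneg_left (norm_adjoint_isometry_apply_le V v) (norm_nonneg _))

end Compression

/-! ### Generalized Toeplitz extensions and their symbols -/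

section ToeplitzExtension

open Filter Topology

variable {X : Type}

/-- An isometry `V : ℓ²(X) → ℓ²(ℤ)` whose range projection essentially commutes with the
translations and contains `δ_j` for all large `j`. -/
structure IsToeplitzIsometry (V : Ell2 X →ₗᵢ[ℂ] Ell2 ℤ) : Prop where
  comm : ∀ n, dilation V 1 * rightTranslation n - rightTranslation n * dilation V 1 ∈
    compactOps (Ell2 ℤ)
  eventually : ∀ᶠ j : ℤ in atTop, dilation V 1 (ell2Delta j) = ell2Delta j

/-- The operators on `ℓ²(ℤ)` which essentially commute with the range projection of `V` and whose
compressions belong to a given algebra containing the compact operators. -/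
def compressionAlgebra (V : Ell2 X →ₗᵢ[ℂ] Ell2 ℤ)
    (G : NonUnitalStarSubalgebra ℂ (Ell2 X →L[ℂ] Ell2 X)) (hG : compactOps (Ell2 X) ⊆ G) :
    NonUnitalStarSubalgebra ℂ (Ell2 ℤ →L[ℂ] Ell2 ℤ) where
  carrier := {A | dilation V 1 * A - A * dilation V 1 ∈ compactOps (Ell2 ℤ) ∧ compression V A ∈ G}
  zero_mem' := by
    refine ⟨?_, ?_⟩
    · simpa using zero_mem_compactOps
    · rw [compression_zero]; exact zero_mem G
  add_mem' := by
    rintro A B ⟨hA, hA'⟩ ⟨hB, hB'⟩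
    refine ⟨?_, ?_⟩
    · convert add_mem_compactOps hA hB using 1
      noncomm_ring
    · rw [compression_add]; exact add_mem hA' hB'
  smul_mem' := by
    rintro c A ⟨hA, hA'⟩
    refine ⟨?_, ?_⟩
    · rw [mul_smul_comm, smul_mul_assoc, ← smul_sub]
      exact smul_mem_compactOps c hA
    · rw [compression_smul]; exact SMulMemClass.smul_mem c hA'
  mul_mem' := by
    rintro A B ⟨hA, hA'⟩ ⟨hB, hB'⟩
    refine ⟨?_, ?_⟩
    · convert add_mem_compactOps (mul_right_mem_compactOps hA B) (mul_left_mem_compactOps A hB)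
        using 1
      noncomm_ring
    · have h := compression_mem_compactOps V (mul_left_mem_compactOps A
        (sub_mem_compactOps_comm hB))
      rw [← compression_mul_sub] at h
      simpa using add_mem (hG h) (mul_mem hA' hB')
  star_mem' := by
    rintro A ⟨hA, hA'⟩
    refine ⟨?_, ?_⟩
    · convert adjoint_mem_compactOps (sub_mem_compactOps_comm hA) using 1
      simp [star_dilation]
    · rw [← star_compression]; exact star_mem hA'

/-- The compression algebra is closed, so both of its conditions need checking only on the $\rho_n$.
This passes essential commutation and membership of compressions from translations to all of
$C(S^1)$. -/
theorem reducedGroupAlgebra_le_compressionAlgebra {V : Ell2 X →ₗᵢ[ℂ] Ell2 ℤ}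
    (hV : IsToeplitzIsometry V) {G : NonUnitalStarSubalgebra ℂ (Ell2 X →L[ℂ] Ell2 X)}
    (hG : compactOps (Ell2 X) ⊆ G) (hcl : IsClosed (G : Set (Ell2 X →L[ℂ] Ell2 X)))
    (hρ : ∀ n, compression V (rightTranslation n) ∈ G) :
    reducedGroupAlgebra ≤ compressionAlgebra V G hG := by
  refine generatedCStarAlgebra_le ?_ ?_
  · have h1 : Continuous fun A : Ell2 ℤ →L[ℂ] Ell2 ℤ => dilation V 1 * A - A * dilation V 1 := by
      fun_prop
    exact (isClosed_compactOps.preimage h1).inter (hcl.preimage (continuous_compression V))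
  · rintro _ ⟨n, rfl⟩
    exact ⟨hV.comm n, hρ n⟩

theorem IsToeplitzIsometry.comm_circleRep {V : Ell2 X →ₗᵢ[ℂ] Ell2 ℤ} (hV : IsToeplitzIsometry V)
    (f : C(Circle, ℂ)) :
    dilation V 1 * circleRep f - circleRep f * dilation V 1 ∈ compactOps (Ell2 ℤ) :=
  (reducedGroupAlgebra_le_compressionAlgebra hV (G := ⊤) (fun _ _ => trivial) isClosed_univ
    (fun _ => trivial) (circleRep_mem f)).1

theorem circleRep_rightTranslation_apply (f : C(Circle, ℂ)) (n : ℤ) (ξ : Ell2 ℤ) :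
    circleRep f (rightTranslation n ξ) = rightTranslation n (circleRep f ξ) := by
  rw [← circleRep_circlePow, ← mul_apply_eq_comp, ← mul_apply_eq_comp, ← map_mul, ← map_mul,
    mul_comm]

/-- An operator which is a compact perturbation of the compression of `f ∈ C(S¹)` has norm at
least `‖f‖`. -/
theorem IsToeplitzIsometry.norm_le {V : Ell2 X →ₗᵢ[ℂ] Ell2 ℤ} (hV : IsToeplitzIsometry V)
    {T : Ell2 X →L[ℂ] Ell2 X} {f : C(Circle, ℂ)}
    (h : T - compression V (circleRep f) ∈ compactOps (Ell2 X)) : ‖f‖ ≤ ‖T‖ := by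
  set A := circleRep f with hA
  set Q := dilation V 1 with hQ
  set R := dilation V T - A with hR
  -- $R$ is a compact operator plus $A(Q-1)$: the first sends $\delta_j$ to vectors tending to $0$,
  -- the second kills $\delta_j$ for large $j$.
  have hRdelta : Tendsto (fun j : ℤ => R (ell2Delta j)) atTop (𝓝 0) := by
    have hC : dilation V (T - compression V A) + (Q * A - A * Q) * Q ∈ compactOps (Ell2 ℤ) :=
      add_mem_compactOps (dilation_mem_compactOps V h)
        (mul_right_mem_compactOps (hV.comm_circleRep f) Q)
    have hRC : R = dilation V (T - compression V A) + (Q * A - A * Q) * Q + (A * Q - A) := by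
      rw [dilation_sub, dilation_compression, ← hQ, sub_mul, mul_assoc A Q Q, hQ,
        dilation_one_mul_self, hR]
      abel
    have h1 := (tendsto_compact_ell2Delta hC).mono_left
      ((atTop_le_cofinite : (atTop : Filter ℤ) ≤ cofinite))
    rw [tendsto_zero_iff_norm_tendsto_zero]
    refine h1.congr' ?_
    filter_upwards [hV.eventually] with j hj
    have h2 : (A * Q - A) (ell2Delta j) = 0 := by
      rw [sub_apply, mul_apply_eq_comp, hj, sub_self]
    rw [hRC, add_apply (_ + _), h2, add_zero]
  -- The vectors whose far translates are asymptotically killed by $R$; a subspace containing every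
  -- $\delta_j$, hence dense.
  let p : Submodule ℂ (Ell2 ℤ) :=
    { carrier := {ξ | Tendsto (fun k : ℤ => R (rightTranslation k ξ)) atTop (𝓝 0)}
      zero_mem' := by simp
      add_mem' := fun {ξ η} hξ hη => by
        simpa using Tendsto.add (f := fun k : ℤ => R (rightTranslation k ξ)) hξ hη
      smul_mem' := fun c ξ hξ => by
        simpa using Tendsto.const_smul (f := fun k : ℤ => R (rightTranslation k ξ)) hξ c }
  have hdelta : ∀ j, ell2Delta j ∈ p := by
    intro j
    change Tendsto (fun k : ℤ => R (rightTranslation k (ell2Delta j))) atTop (𝓝 0)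
    simp only [rightTranslation_delta]
    exact hRdelta.comp (tendsto_atTop_add_const_left _ _ tendsto_id)
  -- $A$ commutes with the isometric translations, so
  -- $\|A\xi\|=\|A\rho_k\xi\|\le\|T\|\|\xi\|+\|R\rho_k\xi\|$, and the last term vanishes as
  -- $k\to\infty$.
  have hp : ∀ ξ ∈ p, ‖A ξ‖ ≤ ‖T‖ * ‖ξ‖ := by
    intro ξ hξ
    have h1 : Tendsto (fun k : ℤ => ‖T‖ * ‖ξ‖ + ‖R (rightTranslation k ξ)‖) atTop
        (𝓝 (‖T‖ * ‖ξ‖ + ‖(0 : Ell2 ℤ)‖)) := tendsto_const_nhds.add hξ.norm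
    rw [norm_zero, add_zero] at h1
    refine ge_of_tendsto h1 (Eventually.of_forall fun k => ?_)
    have h2 : rightTranslation k (A ξ) =
        dilation V T (rightTranslation k ξ) - R (rightTranslation k ξ) := by
      rw [hR, sub_apply, sub_sub_cancel, hA, circleRep_rightTranslation_apply]
    rw [← norm_rightTranslation_apply k (A ξ), h2]
    refine (norm_sub_le _ _).trans (add_le_add_left ?_ _)
    rw [← norm_rightTranslation_apply k ξ]
    exact norm_dilation_apply_le V T _
  rw [← norm_circleRep f]
  refine ContinuousLinearMap.opNorm_le_bound _ (norm_nonneg _) fun ξ => ?_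
  have hcl : IsClosed {ξ : Ell2 ℤ | ‖A ξ‖ ≤ ‖T‖ * ‖ξ‖} :=
    isClosed_le (by fun_prop) (by fun_prop)
  exact hcl.mem_of_tendsto (hasSum_ell2Delta ξ) (Eventually.of_forall fun s =>
    hp _ (p.sum_mem fun x _ => p.smul_mem _ (hdelta x)))

/-- The norm estimate is applied to the zero operator, which then has symbol $f-g$. -/
theorem IsToeplitzIsometry.symbol_unique {V : Ell2 X →ₗᵢ[ℂ] Ell2 ℤ} (hV : IsToeplitzIsometry V)
    {T : Ell2 X →L[ℂ] Ell2 X} {f g : C(Circle, ℂ)}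
    (hf : T - compression V (circleRep f) ∈ compactOps (Ell2 X))
    (hg : T - compression V (circleRep g) ∈ compactOps (Ell2 X)) : f = g := by
  have h : (0 : Ell2 X →L[ℂ] Ell2 X) - compression V (circleRep (f - g)) ∈
      compactOps (Ell2 X) := by
    convert sub_mem_compactOps hf hg using 1
    rw [map_sub, compression_sub]
    abel
  have := hV.norm_le h
  rw [norm_zero] at this
  exact sub_eq_zero.1 (norm_le_zero_iff.1 this)

theorem IsToeplitzIsometry.mul_symbol {V : Ell2 X →ₗᵢ[ℂ] Ell2 ℤ} (hV : IsToeplitzIsometry V)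
    {S T : Ell2 X →L[ℂ] Ell2 X} {f g : C(Circle, ℂ)}
    (hf : S - compression V (circleRep f) ∈ compactOps (Ell2 X))
    (hg : T - compression V (circleRep g) ∈ compactOps (Ell2 X)) :
    S * T - compression V (circleRep (f * g)) ∈ compactOps (Ell2 X) := by
  have h1 := compression_mem_compactOps V (mul_left_mem_compactOps (circleRep f)
    (hV.comm_circleRep g))
  have h2 : compression V (circleRep f * (dilation V 1 * circleRep g -
      circleRep g * dilation V 1)) = compression V (circleRep f) * compression V (circleRep g) -
        compression V (circleRep f * circleRep g) := by
    rw [← neg_sub, ← neg_sub (compression V (circleRep f * circleRep g)), compression_mul_sub,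
      mul_neg, ← zero_sub, compression_sub, compression_zero, zero_sub]
  rw [h2] at h1
  have h3 := add_mem_compactOps (add_mem_compactOps (mul_right_mem_compactOps hf T)
    (mul_left_mem_compactOps (compression V (circleRep f)) hg)) h1
  convert h3 using 1
  rw [map_mul]
  noncomm_ring

theorem add_symbol {V : Ell2 X →ₗᵢ[ℂ] Ell2 ℤ}
    {S T : Ell2 X →L[ℂ] Ell2 X} {f g : C(Circle, ℂ)}
    (hf : S - compression V (circleRep f) ∈ compactOps (Ell2 X))
    (hg : T - compression V (circleRep g) ∈ compactOps (Ell2 X)) :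
    S + T - compression V (circleRep (f + g)) ∈ compactOps (Ell2 X) := by
  convert add_mem_compactOps hf hg using 1
  rw [map_add, compression_add]
  abel

theorem smul_symbol {V : Ell2 X →ₗᵢ[ℂ] Ell2 ℤ} (c : ℂ)
    {T : Ell2 X →L[ℂ] Ell2 X} {f : C(Circle, ℂ)}
    (hf : T - compression V (circleRep f) ∈ compactOps (Ell2 X)) :
    c • T - compression V (circleRep (c • f)) ∈ compactOps (Ell2 X) := by
  convert smul_mem_compactOps c hf using 1
  rw [map_smul, compression_smul, smul_sub]

theorem star_symbol {V : Ell2 X →ₗᵢ[ℂ] Ell2 ℤ}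
    {T : Ell2 X →L[ℂ] Ell2 X} {f : C(Circle, ℂ)}
    (hf : T - compression V (circleRep f) ∈ compactOps (Ell2 X)) :
    star T - compression V (circleRep (star f)) ∈ compactOps (Ell2 X) := by
  convert adjoint_mem_compactOps hf using 1
  rw [map_star, ← star_compression, star_sub]

theorem mem_symbol_zero_iff {V : Ell2 X →ₗᵢ[ℂ] Ell2 ℤ} {T : Ell2 X →L[ℂ] Ell2 X} :
    T - compression V (circleRep 0) ∈ compactOps (Ell2 X) ↔ T ∈ compactOps (Ell2 X) := by
  rw [map_zero, compression_zero, sub_zero]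

/-- The compact perturbations of the compressions of the elements of `C(S¹)`. -/
def generalizedToeplitzAlgebra (V : Ell2 X →ₗᵢ[ℂ] Ell2 ℤ) (hV : IsToeplitzIsometry V) :
    NonUnitalStarSubalgebra ℂ (Ell2 X →L[ℂ] Ell2 X) where
  carrier := {T | ∃ f, T - compression V (circleRep f) ∈ compactOps (Ell2 X)}
  zero_mem' := ⟨0, mem_symbol_zero_iff.2 zero_mem_compactOps⟩
  add_mem' := fun ⟨_, hf⟩ ⟨_, hg⟩ => ⟨_, add_symbol hf hg⟩
  smul_mem' := fun c _ ⟨_, hf⟩ => ⟨_, smul_symbol c hf⟩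
  mul_mem' := fun ⟨_, hf⟩ ⟨_, hg⟩ => ⟨_, hV.mul_symbol hf hg⟩
  star_mem' := fun ⟨_, hf⟩ => ⟨_, star_symbol hf⟩

/-- By the norm estimate the symbols of a convergent sequence are Cauchy, and their limit is a
symbol of the limit operator. -/
theorem isClosed_generalizedToeplitzAlgebra (V : Ell2 X →ₗᵢ[ℂ] Ell2 ℤ)
    (hV : IsToeplitzIsometry V) :
    IsClosed (generalizedToeplitzAlgebra V hV : Set (Ell2 X →L[ℂ] Ell2 X)) := by
  refine IsSeqClosed.isClosed fun T T₀ hT hlim => ?_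
  choose f hf using hT
  have hcauchy : CauchySeq f := by
    rw [Metric.cauchySeq_iff]
    intro ε hε
    obtain ⟨N, hN⟩ := Metric.cauchySeq_iff.1 hlim.cauchySeq ε hε
    refine ⟨N, fun m hm n hn => lt_of_le_of_lt ?_ (hN m hm n hn)⟩
    rw [dist_eq_norm, dist_eq_norm]
    refine hV.norm_le ?_
    convert sub_mem_compactOps (hf m) (hf n) using 1
    rw [map_sub, compression_sub]
    abel
  obtain ⟨f₀, hf₀⟩ := cauchySeq_tendsto_of_complete hcauchy
  have hcont : Continuous fun g => compression V (circleRep g) :=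
    (continuous_compression V).comp circleRep_isometry.continuous
  exact ⟨f₀, isClosed_compactOps.mem_of_tendsto (hlim.sub ((hcont.tendsto f₀).comp hf₀))
    (Eventually.of_forall hf)⟩

/-- The symbol map of the algebra of compact perturbations of compressions. -/
def symbolMap (V : Ell2 X →ₗᵢ[ℂ] Ell2 ℤ) (hV : IsToeplitzIsometry V) :
    generalizedToeplitzAlgebra V hV →⋆ₙₐ[ℂ] C(Circle, ℂ) where
  -- A symbol is chosen arbitrarily; uniqueness of symbols makes the choice compatible with all
  -- operations.
  toFun T := T.2.choose
  map_smul' c T := hV.symbol_unique (c • T).2.choose_spec (smul_symbol c T.2.choose_spec)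
  map_zero' := hV.symbol_unique (0 : generalizedToeplitzAlgebra V hV).2.choose_spec
    (mem_symbol_zero_iff.2 zero_mem_compactOps)
  map_add' S T := hV.symbol_unique (S + T).2.choose_spec
    (add_symbol S.2.choose_spec T.2.choose_spec)
  map_mul' S T := hV.symbol_unique (S * T).2.choose_spec
    (hV.mul_symbol S.2.choose_spec T.2.choose_spec)
  map_star' T := hV.symbol_unique (star T).2.choose_spec (star_symbol T.2.choose_spec)

theorem symbolMap_eq_iff {V : Ell2 X →ₗᵢ[ℂ] Ell2 ℤ} {hV : IsToeplitzIsometry V}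
    {T : generalizedToeplitzAlgebra V hV} {f : C(Circle, ℂ)} :
    symbolMap V hV T = f ↔
      (T : Ell2 X →L[ℂ] Ell2 X) - compression V (circleRep f) ∈ compactOps (Ell2 X) := by
  constructor
  · rintro rfl
    exact T.2.choose_spec
  · exact hV.symbol_unique T.2.choose_spec

/-- The extension of `C(S¹)` by the compact operators given by the compact perturbations of
the compressions of the elements of `C(S¹)`. -/
def toeplitzExtension (V : Ell2 X →ₗᵢ[ℂ] Ell2 ℤ) (hV : IsToeplitzIsometry V) :
    CompactExtension C(Circle, ℂ) (Ell2 X) where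
  algebra := generalizedToeplitzAlgebra V hV
  closed := isClosed_generalizedToeplitzAlgebra V hV
  compact_mem _ hT := ⟨0, mem_symbol_zero_iff.2 hT⟩
  quot := symbolMap V hV
  surjective f := ⟨⟨compression V (circleRep f), f, by
    rw [sub_self]; exact zero_mem_compactOps⟩, symbolMap_eq_iff.2 (by
      rw [sub_self]; exact zero_mem_compactOps)⟩
  ker _ := symbolMap_eq_iff.trans mem_symbol_zero_iff

theorem toeplitzExtension_lifts {V : Ell2 X →ₗᵢ[ℂ] Ell2 ℤ} (hV : IsToeplitzIsometry V)
    {T : Ell2 X →L[ℂ] Ell2 X} {f : C(Circle, ℂ)}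
    (h : T - compression V (circleRep f) ∈ compactOps (Ell2 X)) :
    (toeplitzExtension V hV).Lifts T f :=
  ⟨⟨f, h⟩, symbolMap_eq_iff.2 h⟩

theorem toeplitzExtension_lifts_compression {V : Ell2 X →ₗᵢ[ℂ] Ell2 ℤ} (hV : IsToeplitzIsometry V)
    (f : C(Circle, ℂ)) : (toeplitzExtension V hV).Lifts (compression V (circleRep f)) f :=
  toeplitzExtension_lifts hV (by rw [sub_self]; exact zero_mem_compactOps)

/-- Criterion for recognizing a concretely generated algebra: its generators have symbols, and it
contains the compacts and the compressed translations. -/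
theorem toeplitzExtension_algebra_eq {V : Ell2 X →ₗᵢ[ℂ] Ell2 ℤ} (hV : IsToeplitzIsometry V)
    {S : Set (Ell2 X →L[ℂ] Ell2 X)}
    (hS : ∀ T ∈ S, ∃ f, T - compression V (circleRep f) ∈ compactOps (Ell2 X))
    (hK : compactOps (Ell2 X) ⊆ generatedCStarAlgebra S)
    (hρ : ∀ n, compression V (rightTranslation n) ∈ generatedCStarAlgebra S) :
    (toeplitzExtension V hV).algebra = generatedCStarAlgebra S := by
  refine le_antisymm ?_
    (generatedCStarAlgebra_le (isClosed_generalizedToeplitzAlgebra V hV) fun T hT => hS T hT)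
  rintro T ⟨f, hf⟩
  have h := (reducedGroupAlgebra_le_compressionAlgebra hV hK (isClosed_generatedCStarAlgebra S) hρ
    (circleRep_mem f)).2
  simpa using add_mem (hK hf) h

/-- The Fredholm module `(ℓ²(ℤ), γ, 2 V V* - 1)`. -/
def toeplitzModule (V : Ell2 X →ₗᵢ[ℂ] Ell2 ℤ) (hV : IsToeplitzIsometry V) :
    FredholmModule C(Circle, ℂ) where
  H := Ell2 ℤ
  rep := regularRep circleEquiv
  F := (2 : ℂ) • dilation V 1 - 1
  comm f := by
    rw [regularRep_circleEquiv]
    convert smul_mem_compactOps (2 : ℂ) (hV.comm_circleRep f) using 1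
    rw [sub_mul, mul_sub, smul_mul_assoc, mul_smul_comm, smul_sub, one_mul, mul_one]
    abel
  sq f := by
    have h : ((2 : ℂ) • dilation V 1 - 1) * ((2 : ℂ) • dilation V 1 - 1) - 1 = 0 := by
      rw [two_smul]
      calc _ = (4 : ℤ) • (dilation V 1 * dilation V 1 - dilation V 1) := by noncomm_ring
        _ = 0 := by rw [dilation_one_mul_self, sub_self, smul_zero]
    rw [h, mul_zero]
    exact zero_mem_compactOps
  selfAdj f := by
    have h : star ((2 : ℂ) • dilation V 1 - 1) = (2 : ℂ) • dilation V 1 - 1 := by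
      simp [star_dilation]
    rw [h, sub_self, mul_zero]
    exact zero_mem_compactOps

theorem toeplitzExtension_representedVia {V : Ell2 X →ₗᵢ[ℂ] Ell2 ℤ} (hV : IsToeplitzIsometry V) :
    (toeplitzExtension V hV).RepresentedVia (toeplitzModule V hV) V :=
  ⟨rfl, toeplitzExtension_lifts_compression hV⟩

end ToeplitzExtension

/-! ### The punctured line -/

section ClosedGap

open Filter Topology InnerProductSpace

theorem restrictedTranslation_of_mem {X : Set ℤ} {n : ℤ} {j : X} (h : (j : ℤ) + n ∈ X) :
    (restrictedTranslation X n).toPEquiv j = some ⟨j + n, h⟩ :=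
  dif_pos h

theorem restrictedTranslation_of_notMem {X : Set ℤ} {n : ℤ} {j : X} (h : (j : ℤ) + n ∉ X) :
    (restrictedTranslation X n).toPEquiv j = none :=
  dif_neg h

theorem translationOperator_delta_of_mem {X : Set ℤ} {n : ℤ} {j : X} (h : (j : ℤ) + n ∈ X) :
    translationOperator X n (ell2Delta j) = ell2Delta ⟨j + n, h⟩ :=
  inducedOperator_delta_of_eq_some _ (restrictedTranslation_of_mem h)

theorem translationOperator_delta_of_notMem {X : Set ℤ} {n : ℤ} {j : X} (h : (j : ℤ) + n ∉ X) :
    translationOperator X n (ell2Delta j) = 0 :=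
  inducedOperator_delta_of_eq_none _ (restrictedTranslation_of_notMem h)

theorem translationAlgebra_eq (X : Set ℤ) :
    translationAlgebra X = generatedCStarAlgebra (Set.range (translationOperator X)) := by
  unfold translationAlgebra partialTranslationAlgebra
  rw [← Set.range_comp]
  rfl

theorem translationOperator_mem (X : Set ℤ) (n : ℤ) :
    translationOperator X n ∈ translationAlgebra X := by
  rw [translationAlgebra_eq]
  exact subset_generatedCStarAlgebra _ ⟨n, rfl⟩

theorem closeGap_injective : Function.Injective closeGap := by
  rintro ⟨i, hi⟩ ⟨j, hj⟩ h
  change i ≠ 0 at hi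
  change j ≠ 0 at hj
  simp only [closeGap] at h
  ext
  change i = j
  split_ifs at h <;> omega

theorem closeGap_bijective : Function.Bijective closeGap := by
  refine ⟨closeGap_injective, fun i => ?_⟩
  by_cases hi : 0 < i
  · exact ⟨⟨i, hi.ne'⟩, if_pos hi⟩
  · refine ⟨⟨i - 1, show i - 1 ≠ 0 by omega⟩, ?_⟩
    simp only [closeGap]
    rw [if_neg (by omega)]
    omega

/-- The unitary `ℓ²(ℤ ∖ {0}) → ℓ²(ℤ)` induced by closing the gap at `0`. -/
def closeGapUnitary : Ell2 puncturedInt ≃ₗᵢ[ℂ] Ell2 ℤ :=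
  LinearIsometryEquiv.ofSurjective (ell2Isometry closeGap closeGap_injective)
    (ell2Isometry_surjective closeGap closeGap_bijective)

theorem closeGapUnitary_delta (j : puncturedInt) :
    closeGapUnitary (ell2Delta j) = ell2Delta (closeGap j) :=
  ell2Isometry_delta closeGap closeGap_injective j

variable {H L : Type} [NormedAddCommGroup H] [InnerProductSpace ℂ H] [CompleteSpace H]
  [NormedAddCommGroup L] [InnerProductSpace ℂ L] [CompleteSpace L]

theorem adjoint_unitary_apply (U : H ≃ₗᵢ[ℂ] L) (v : L) :
    ContinuousLinearMap.adjoint U.toLinearIsometry.toContinuousLinearMap v = U.symm v := by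
  obtain ⟨w, rfl⟩ := U.surjective v
  rw [U.symm_apply_apply]
  exact adjoint_isometry_apply U.toLinearIsometry w

theorem dilation_unitary (U : H ≃ₗᵢ[ℂ] L) (T : H →L[ℂ] H) :
    dilation U.toLinearIsometry T = U.conjStarAlgEquiv T := by
  ext v
  rw [dilation_apply, adjoint_unitary_apply]
  rfl

theorem compression_unitary (U : H ≃ₗᵢ[ℂ] L) (T : L →L[ℂ] L) :
    compression U.toLinearIsometry T = U.conjStarAlgEquiv.symm T := by
  ext v
  rw [compression_apply, adjoint_unitary_apply]
  rfl

theorem isToeplitzIsometry_closeGapUnitary :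
    IsToeplitzIsometry closeGapUnitary.toLinearIsometry where
  comm n := by
    rw [dilation_unitary, map_one, one_mul, mul_one, sub_self]
    exact zero_mem_compactOps
  eventually := by
    rw [dilation_unitary, map_one]
    exact Eventually.of_forall fun _ => rfl

/-- When $|j|>|n|$ the points $j$ and $j+n$ have the same sign, so closing the gap shifts both
equally; the two operators differ on finitely many basis vectors. -/
theorem translationOperator_sub_compression_mem (n : ℤ) :
    translationOperator puncturedInt n -
      compression closeGapUnitary.toLinearIsometry (rightTranslation n) ∈
        compactOps (Ell2 puncturedInt) := by
  refine isCompactOperator_of_finite_support _ (Subtype.val ⁻¹' Set.Icc (-|n|) |n|)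
    ((Set.finite_Icc _ _).preimage Subtype.val_injective.injOn) fun j hj => ?_
  have hj' : (j : ℤ) < -|n| ∨ |n| < (j : ℤ) := by
    by_contra hcon
    push Not at hcon
    exact hj ⟨hcon.1, hcon.2⟩
  have hn1 := neg_abs_le n
  have hn2 := le_abs_self n
  have hmem : (j : ℤ) + n ∈ puncturedInt := by
    change (j : ℤ) + n ≠ 0
    omega
  have hgap : closeGap ⟨j + n, hmem⟩ = closeGap j + n := by
    simp only [closeGap]
    split_ifs <;> omega
  rw [sub_apply, translationOperator_delta_of_mem hmem, compression_apply, adjoint_unitary_apply]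
  change ell2Delta _ - closeGapUnitary.symm (rightTranslation n (closeGapUnitary _)) = 0
  rw [closeGapUnitary_delta, rightTranslation_delta, ← hgap, ← closeGapUnitary_delta,
    LinearIsometryEquiv.symm_apply_apply, sub_self]

theorem compactOps_subset_translationAlgebra :
    compactOps (Ell2 puncturedInt) ⊆ translationAlgebra puncturedInt := by
  have hmem := translationOperator_mem puncturedInt
  have h0 : (-1 : ℤ) ∈ puncturedInt := by
    change (-1 : ℤ) ≠ 0
    omega
  refine compactOps_subset_of_rankOne_mem _ (isClosed_generatedCStarAlgebra _) ⟨-1, h0⟩ ?_ ?_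
  · have h1 : rankOne ℂ (ell2Delta (⟨-1, h0⟩ : puncturedInt)) (ell2Delta ⟨-1, h0⟩) =
        translationOperator puncturedInt 0 -
          translationOperator puncturedInt (-1) * translationOperator puncturedInt 1 := by
      refine ell2_clm_ext fun j => ?_
      have hj : (j : ℤ) + 0 ∈ puncturedInt := by
        rw [add_zero]; exact j.2
      rw [sub_apply, mul_apply_eq_comp, translationOperator_delta_of_mem hj, rankOne_apply,
        inner_ell2Delta_left]
      by_cases h : (j : ℤ) = -1
      · obtain rfl : j = ⟨-1, h0⟩ := Subtype.ext h
        rw [translationOperator_delta_of_notMem (by simp [puncturedInt]), map_zero,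
          ell2Delta_apply_self, one_smul, sub_zero]
        simp
      · have h2 : (j : ℤ) + 1 ∈ puncturedInt := by
          change (j : ℤ) + 1 ≠ 0
          omega
        have h3 : (j : ℤ) + 1 + -1 ∈ puncturedInt := by
          rw [add_neg_cancel_right]; exact j.2
        rw [translationOperator_delta_of_mem h2, translationOperator_delta_of_mem h3,
          ell2Delta_apply_ne (fun h' => h (congrArg Subtype.val h').symm), zero_smul]
        simp
    rw [h1]
    exact sub_mem (hmem 0) (mul_mem (hmem _) (hmem _))
  · intro x
    have h1 : ((⟨-1, h0⟩ : puncturedInt) : ℤ) + ((x : ℤ) + 1) ∈ puncturedInt := by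
      simp only [neg_add_cancel_comm_assoc]
      exact x.2
    refine ⟨_, hmem (x + 1), ?_⟩
    rw [translationOperator_delta_of_mem h1]
    congr 1
    ext
    change -1 + ((x : ℤ) + 1) = x
    ring

/-- The extension of `C(S¹)` by the compact operators given by `C*(ℤ ∖ {0})`. -/
def closedGapExtension : CompactExtension C(Circle, ℂ) (Ell2 puncturedInt) :=
  toeplitzExtension closeGapUnitary.toLinearIsometry isToeplitzIsometry_closeGapUnitary

theorem closedGapExtension_algebra :
    closedGapExtension.algebra = translationAlgebra puncturedInt := by
  have hK := compactOps_subset_translationAlgebra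
  have hs := translationOperator_mem puncturedInt
  rw [translationAlgebra_eq] at *
  refine toeplitzExtension_algebra_eq _ ?_ hK fun n => ?_
  · rintro _ ⟨n, rfl⟩
    refine ⟨circlePow n, ?_⟩
    rw [circleRep_circlePow]
    exact translationOperator_sub_compression_mem n
  · simpa using sub_mem (hs n) (hK (translationOperator_sub_compression_mem n))

theorem closedGapExtension_lifts (n : ℤ) :
    closedGapExtension.Lifts (translationOperator puncturedInt n) (circlePow n) := by
  refine toeplitzExtension_lifts _ ?_
  rw [circleRep_circlePow]
  exact translationOperator_sub_compression_mem n

/-- Compression by a unitary is a $*$-isomorphism, so the canonical lift $U^*\gamma(f)U$ is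
multiplicative. -/
theorem closedGapExtension_isTrivial : closedGapExtension.IsTrivial := by
  have hlift : ∀ f, closedGapExtension.Lifts
      (closeGapUnitary.conjStarAlgEquiv.symm (circleRep f)) f := fun f => by
    rw [← compression_unitary]
    exact toeplitzExtension_lifts_compression _ f
  let σ : C(Circle, ℂ) →⋆ₙₐ[ℂ] (Ell2 puncturedInt →L[ℂ] Ell2 puncturedInt) :=
    (closeGapUnitary.conjStarAlgEquiv.symm : _ →⋆ₙₐ[ℂ] _).comp
      (circleRep : C(Circle, ℂ) →⋆ₙₐ[ℂ] (Ell2 ℤ →L[ℂ] Ell2 ℤ))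
  exact ⟨NonUnitalStarAlgHom.codRestrict σ closedGapExtension.algebra fun f => (hlift f).1,
    fun f => (hlift f).2⟩

theorem image_translationAlgebra :
    closeGapUnitary.conjStarAlgEquiv '' (translationAlgebra puncturedInt : Set _) =
      (reducedGroupAlgebra : Set (Ell2 ℤ →L[ℂ] Ell2 ℤ)) + compactOps (Ell2 ℤ) := by
  rw [← closedGapExtension_algebra]
  ext T
  constructor
  · rintro ⟨S, ⟨f, hf⟩, rfl⟩
    refine Set.mem_add.2 ⟨circleRep f, circleRep_mem f, _,
      dilation_mem_compactOps closeGapUnitary.toLinearIsometry hf, ?_⟩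
    rw [dilation_unitary, compression_unitary, map_sub, StarAlgEquiv.apply_symm_apply]
    abel
  · rintro ⟨A, hA, K, hK, rfl⟩
    obtain ⟨f, rfl⟩ := exists_circleRep_eq hA
    refine ⟨closeGapUnitary.conjStarAlgEquiv.symm (circleRep f + K), ⟨f, ?_⟩,
      StarAlgEquiv.apply_symm_apply _ _⟩
    rw [← compression_unitary, ← compression_sub, add_sub_cancel_left]
    exact compression_mem_compactOps _ hK

theorem closedGapExtension_representedVia :
    closedGapExtension.RepresentedVia (regularModule (regularRep circleEquiv))
      closeGapUnitary.toLinearIsometry := by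
  refine ⟨?_, toeplitzExtension_lifts_compression isToeplitzIsometry_closeGapUnitary⟩
  change (1 : Ell2 ℤ →L[ℂ] Ell2 ℤ) = (2 : ℂ) • dilation closeGapUnitary.toLinearIsometry 1 - 1
  rw [dilation_unitary, map_one, two_smul, add_sub_cancel_right]

theorem regularModule_isDegenerate {A : Type} [NonUnitalCStarAlgebra A]
    (ρ : A →⋆ₙₐ[ℂ] (Ell2 ℤ →L[ℂ] Ell2 ℤ)) : (regularModule ρ).IsDegenerate := by
  intro a
  change 1 * ρ a - ρ a * 1 = 0 ∧ ρ a * (1 * 1 - 1) = 0 ∧ ρ a * (1 - star 1) = 0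
  simp

end ClosedGap

/-! ### The classical Toeplitz extension -/

section Toeplitz

open Filter Topology InnerProductSpace

/-- The isometric inclusion `ℓ²(ℕ) → ℓ²(ℤ)`. -/
def natInclusion : Ell2 ℕ →ₗᵢ[ℂ] Ell2 ℤ :=
  ell2Isometry (fun n : ℕ => (n : ℤ)) Nat.cast_injective

theorem natInclusion_delta (n : ℕ) : natInclusion (ell2Delta n) = ell2Delta (n : ℤ) :=
  ell2Isometry_delta _ Nat.cast_injective n

theorem adjoint_natInclusion_delta (n : ℕ) :
    ContinuousLinearMap.adjoint natInclusion.toContinuousLinearMap (ell2Delta (n : ℤ)) =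
      ell2Delta n :=
  adjoint_ell2Isometry_delta _ Nat.cast_injective n

theorem dilation_natInclusion_delta_of_nonneg {j : ℤ} (hj : 0 ≤ j) :
    dilation natInclusion 1 (ell2Delta j) = ell2Delta j := by
  obtain ⟨n, rfl⟩ := Int.eq_ofNat_of_zero_le hj
  rw [dilation_apply, adjoint_natInclusion_delta]
  exact natInclusion_delta n

theorem dilation_natInclusion_delta_of_neg {j : ℤ} (hj : j < 0) :
    dilation natInclusion 1 (ell2Delta j) = 0 := by
  rw [dilation_apply, natInclusion, adjoint_ell2Isometry_delta_of_notMem_range _ _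
    (by rintro ⟨n, rfl⟩; exact not_lt.2 (Int.natCast_nonneg n) hj), map_zero, map_zero]

theorem isToeplitzIsometry_natInclusion : IsToeplitzIsometry natInclusion where
  comm n := by
    refine isCompactOperator_of_finite_support _ (Set.Icc (-|n|) |n|)
      (Set.finite_Icc _ _) fun j hj => ?_
    -- Outside this window $j$ and $j+n$ are both negative or both nonnegative, and the projection
    -- onto $\ell^2(\mathbb N)$ treats them alike.
    have hj' : j < -|n| ∨ |n| < j := by
      by_contra hcon
      push Not at hcon
      exact hj ⟨hcon.1, hcon.2⟩
    have hn1 := neg_abs_le n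
    have hn2 := le_abs_self n
    rw [sub_apply, mul_apply_eq_comp, mul_apply_eq_comp, rightTranslation_delta]
    rcases hj' with h | h
    · rw [dilation_natInclusion_delta_of_neg (by omega),
        dilation_natInclusion_delta_of_neg (by omega), map_zero, sub_zero]
    · rw [dilation_natInclusion_delta_of_nonneg (by omega),
        dilation_natInclusion_delta_of_nonneg (by omega), rightTranslation_delta, sub_self]
  eventually := (eventually_ge_atTop 0).mono fun _ => dilation_natInclusion_delta_of_nonneg

theorem unilateralShift_delta (n : ℕ) : unilateralShift (ell2Delta n) = ell2Delta (n + 1) :=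
  inducedOperator_delta_of_eq_some _ rfl

theorem unilateralShift_pow_delta (m n : ℕ) :
    (unilateralShift ^ m) (ell2Delta n) = ell2Delta (n + m) := by
  induction m with
  | zero => rfl
  | succ m ih => rw [pow_succ', mul_apply_eq_comp, ih, unilateralShift_delta]; rfl

theorem unilateralShift_pow_eq_compression (m : ℕ) :
    unilateralShift ^ m = compression natInclusion (rightTranslation m) := by
  refine ell2_clm_ext fun n => ?_
  rw [unilateralShift_pow_delta, compression_apply, natInclusion_delta, rightTranslation_delta,
    ← Nat.cast_add, adjoint_natInclusion_delta]

theorem unilateralShift_apply_zero (f : Ell2 ℕ) : (unilateralShift f : ℕ → ℂ) 0 = 0 := rfl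

theorem unilateralShift_apply_succ (f : Ell2 ℕ) (n : ℕ) :
    (unilateralShift f : ℕ → ℂ) (n + 1) = f n := rfl

theorem unilateralShift_injective : Function.Injective unilateralShift := by
  intro f g h
  ext n
  rw [← unilateralShift_apply_succ f, h, unilateralShift_apply_succ]

theorem unilateralShift_not_surjective : ¬ Function.Surjective unilateralShift := by
  intro h
  obtain ⟨f, hf⟩ := h (ell2Delta 0)
  have := unilateralShift_apply_zero f
  rw [hf, ell2Delta_apply_self] at this
  exact one_ne_zero this

theorem star_unilateralShift_delta_succ (n : ℕ) :
    star unilateralShift (ell2Delta (n + 1)) = ell2Delta n := by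
  ext m
  rw [← inner_ell2Delta_left, ContinuousLinearMap.star_eq_adjoint,
    ContinuousLinearMap.adjoint_inner_right, unilateralShift_delta, inner_ell2Delta_left]
  by_cases h : m = n
  · rw [h, ell2Delta_apply_self, ell2Delta_apply_self]
  · rw [ell2Delta_apply_ne h, ell2Delta_apply_ne (by omega)]

theorem star_unilateralShift_delta_zero : star unilateralShift (ell2Delta 0) = 0 := by
  ext m
  rw [← inner_ell2Delta_left, ContinuousLinearMap.star_eq_adjoint,
    ContinuousLinearMap.adjoint_inner_right, unilateralShift_delta, inner_ell2Delta_left,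
    ell2Delta_apply_ne (by omega)]
  rfl

theorem unilateralShift_mem : unilateralShift ∈ toeplitzAlgebra :=
  subset_generatedCStarAlgebra _ rfl

theorem one_mem_toeplitzAlgebra : (1 : Ell2 ℕ →L[ℂ] Ell2 ℕ) ∈ toeplitzAlgebra := by
  have h : star unilateralShift * unilateralShift = 1 := ell2_clm_ext fun n => by
    rw [mul_apply_eq_comp, unilateralShift_delta, star_unilateralShift_delta_succ]
    rfl
  rw [← h]
  exact mul_mem (star_mem unilateralShift_mem) unilateralShift_mem

theorem unilateralShift_pow_mem (m : ℕ) : unilateralShift ^ m ∈ toeplitzAlgebra := by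
  induction m with
  | zero => exact one_mem_toeplitzAlgebra
  | succ m ih => rw [pow_succ]; exact mul_mem ih unilateralShift_mem

theorem compactOps_subset_toeplitzAlgebra : compactOps (Ell2 ℕ) ⊆ toeplitzAlgebra := by
  refine compactOps_subset_of_rankOne_mem _ (isClosed_generatedCStarAlgebra _) 0 ?_ fun n => ?_
  · have h : rankOne ℂ (ell2Delta 0) (ell2Delta 0) =
        1 - unilateralShift * star unilateralShift := by
      refine ell2_clm_ext fun n => ?_
      rw [rankOne_apply, inner_ell2Delta_left, sub_apply, mul_apply_eq_comp, one_apply_eq_self]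
      rcases n with _ | n
      · rw [ell2Delta_apply_self, star_unilateralShift_delta_zero, map_zero, one_smul, sub_zero]
      · rw [ell2Delta_apply_ne (by omega), star_unilateralShift_delta_succ, unilateralShift_delta,
          zero_smul, sub_self]
    rw [h]
    exact sub_mem one_mem_toeplitzAlgebra (mul_mem unilateralShift_mem
      (star_mem unilateralShift_mem))
  · refine ⟨_, unilateralShift_pow_mem n, ?_⟩
    rw [unilateralShift_pow_delta, zero_add]

theorem compression_natInclusion_mem (n : ℤ) :
    compression natInclusion (rightTranslation n) ∈ toeplitzAlgebra := by
  obtain ⟨m, rfl | rfl⟩ := n.eq_nat_or_neg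
  · rw [← unilateralShift_pow_eq_compression]
    exact unilateralShift_pow_mem m
  · rw [← star_rightTranslation, ← star_compression, ← unilateralShift_pow_eq_compression]
    exact star_mem (unilateralShift_pow_mem m)

/-- The Toeplitz extension. -/
def classicalToeplitzExtension : CompactExtension C(Circle, ℂ) (Ell2 ℕ) :=
  toeplitzExtension natInclusion isToeplitzIsometry_natInclusion

theorem unilateralShift_sub_compression_mem :
    unilateralShift - compression natInclusion (circleRep (circlePow 1)) ∈
      compactOps (Ell2 ℕ) := by
  have h := unilateralShift_pow_eq_compression 1
  rw [pow_one, Nat.cast_one] at h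
  rw [circleRep_circlePow, ← h, sub_self]
  exact zero_mem_compactOps

theorem classicalToeplitzExtension_algebra :
    classicalToeplitzExtension.algebra = toeplitzAlgebra := by
  refine toeplitzExtension_algebra_eq _ ?_ compactOps_subset_toeplitzAlgebra
    compression_natInclusion_mem
  rintro _ rfl
  exact ⟨circlePow 1, unilateralShift_sub_compression_mem⟩

theorem classicalToeplitzExtension_lifts :
    classicalToeplitzExtension.Lifts unilateralShift (circlePow 1) :=
  toeplitzExtension_lifts _ unilateralShift_sub_compression_mem

end Toeplitz

/-! ### Distinguishing the two classes by the index of $z$ -/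

section Inequivalence

theorem toeplitzExtension_lifts_one {X : Type} {V : Ell2 X →ₗᵢ[ℂ] Ell2 ℤ}
    (hV : IsToeplitzIsometry V) : (toeplitzExtension V hV).Lifts 1 1 := by
  have h := toeplitzExtension_lifts_compression hV 1
  rwa [map_one, compression_one] at h

/-- Writes $z^mz^n=1$ in terms of $a=z^m-1$ and $b=z^n-1$, the form in which the pairing takes
invertible elements. -/
theorem circlePow_quasiInverse (m n : ℤ) (h : m + n = 0) :
    (circlePow m - 1) + (circlePow n - 1) + (circlePow m - 1) * (circlePow n - 1) = 0 := by
  have h1 : circlePow m * circlePow n = 1 := by rw [← circlePow_add, h, circlePow_zero]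
  linear_combination h1

/-- $U^*\rho_1U$ is a unitary lift of $z$, so $1+R$ is invertible for the lift $R$ of $z-1$ chosen
here. -/
theorem nullIndex_of_representedBy_closedGapExtension {x : FredholmModule C(Circle, ℂ)}
    (hx : closedGapExtension.RepresentedBy x) :
    NullIndex (indexOperator x.rep x.F (circlePow 1 - 1)) := by
  obtain ⟨V, hV⟩ := hx
  have hR : closedGapExtension.Lifts
      (compression closeGapUnitary.toLinearIsometry (circleRep (circlePow 1)) - 1)
      (circlePow 1 - 1) :=
    (toeplitzExtension_lifts_compression _ _).sub (toeplitzExtension_lifts_one _)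
  refine (nullIndex_congr (hV.indexOperator_sub_mem hR)).2
    (NullIndex.of_isUnit (isUnit_one_add_dilation V ?_))
  rw [add_sub_cancel, compression_unitary, circleRep_circlePow]
  exact (Unitary.toUnits ⟨_, rightTranslation_mem_unitary 1⟩).isUnit.map
    closeGapUnitary.conjStarAlgEquiv.symm

/-- The shift lifts $z$; index zero would turn its injectivity into surjectivity, yet $\delta_0$ is
not in its range. -/
theorem not_nullIndex_of_representedBy_classicalToeplitzExtension
    {y : FredholmModule C(Circle, ℂ)} (hy : classicalToeplitzExtension.RepresentedBy y) :
    ¬ NullIndex (indexOperator y.rep y.F (circlePow 1 - 1)) := by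
  intro h
  obtain ⟨V, hV⟩ := hy
  have hR : classicalToeplitzExtension.Lifts (unilateralShift - 1) (circlePow 1 - 1) :=
    classicalToeplitzExtension_lifts.sub (toeplitzExtension_lifts_one _)
  have h1 :=
    ((nullIndex_congr (hV.indexOperator_sub_mem hR)).1 h).of_dilation.surjective_of_injective
  rw [add_sub_cancel] at h1
  exact unilateralShift_not_surjective (h1 unilateralShift_injective)

theorem not_kHomologyEquivalent_classicalToeplitzExtension :
    ¬ closedGapExtension.KHomologyEquivalent classicalToeplitzExtension := by
  rintro ⟨x, y, hx, hy, hxy⟩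
  exact not_nullIndex_of_representedBy_classicalToeplitzExtension hy
    ((hxy.nullIndex_iff (circlePow_quasiInverse 1 (-1) (by norm_num))
      (circlePow_quasiInverse (-1) 1 (by norm_num))).1
        (nullIndex_of_representedBy_closedGapExtension hx))

end Inequivalence

end

theorem mainTheorem4 :
    ∃ (U : Ell2 puncturedInt ≃ₗᵢ[ℂ] Ell2 ℤ)
      (γ : C(Circle, ℂ) ≃⋆ₐ[ℂ] reducedGroupAlgebra)
      (e : CompactExtension C(Circle, ℂ) (Ell2 puncturedInt))
      (τ : CompactExtension C(Circle, ℂ) (Ell2 ℕ)),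
      -- the unitary `U` is induced by the bijection closing the gap at `0`
      (∀ j, U (ell2Delta j) = ell2Delta (closeGap j)) ∧
      -- `C(S¹)` is identified with `C*_ρ(ℤ)`
      (∀ n, (γ (circlePow n) : Ell2 ℤ →L[ℂ] Ell2 ℤ) = rightTranslation n) ∧
      -- `U C*(ℤ ∖ {0}) U* = C*_ρ(ℤ) + 𝒦(ℓ²(ℤ))`
      U.conjStarAlgEquiv '' (translationAlgebra puncturedInt : Set _) =
        (reducedGroupAlgebra : Set (Ell2 ℤ →L[ℂ] Ell2 ℤ)) + compactOps (Ell2 ℤ) ∧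
      -- `C*(ℤ ∖ {0})` is an extension of `C(S¹)` by the compact operators
      e.algebra = translationAlgebra puncturedInt ∧
      (∀ n, e.Lifts (translationOperator puncturedInt n) (circlePow n)) ∧
      -- this extension is trivial, its `K`-homology cycle being the degenerate `(ℓ²(ℤ), ρ, 1)`
      e.IsTrivial ∧
      e.RepresentedVia (regularModule (regularRep γ)) U.toLinearIsometry ∧
      (regularModule (regularRep γ)).IsDegenerate ∧
      -- the Toeplitz extension
      τ.algebra = toeplitzAlgebra ∧
      τ.Lifts unilateralShift (circlePow 1) ∧
      (∃ y, τ.RepresentedBy y) ∧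
      -- the two extensions are not equivalent in `K`-homology
      ¬ e.KHomologyEquivalent τ := by
  exact ⟨closeGapUnitary, circleEquiv, closedGapExtension, classicalToeplitzExtension,
    closeGapUnitary_delta, circleRep_circlePow, image_translationAlgebra,
    closedGapExtension_algebra, closedGapExtension_lifts, closedGapExtension_isTrivial,
    closedGapExtension_representedVia, regularModule_isDegenerate _,
    classicalToeplitzExtension_algebra, classicalToeplitzExtension_lifts,
    ⟨_, _, toeplitzExtension_representedVia isToeplitzIsometry_natInclusion⟩,
    not_kHomologyEquivalent_classicalToeplitzExtension⟩
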